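/- Let $\mathcal X,\mathcal Y$ be finite sets, let $P_{\mathcal X}(\cdot|x)$ and $P_{\mathcal Y}(\cdot|y)$ be Markov transition kernels on $\mathcal X$ and $\mathcal Y$, let $c:\mathcal X\times\mathcal Y\to[0,\infty)$, $\gamma\in(0,1)$, and let $x_0\in\mathcal X$, $y_0\in\mathcal Y$. Let $M_{\mathcal X}$, $M_{\mathcal Y}$ be the laws of the Markov chains $(X_t)_{t\ge0}$, $(Y_t)_{t\ge0}$ with these kernels, started at $x_0$, $y_0$. **Distance.** A coupling $M$ of $M_{\mathcal X}$ and $M_{\mathcal Y}$ (a probability measure on $(\mathcal X\times\mathcal Y)^{\mathbb N}$ with these marginals) is *bicausal* if for every $n\ge 1$ and every joint history $\bar x_{n-1}\bar y_{n-1}$ of positive $M$-probability, $\sum_{y_n}M(x_ny_n|\bar x_{n-1}\bar y_{n-1})=M_{\mathcal X}(x_n|\bar x_{n-1})$ for all $x_n$ and $\sum_{x_n}M(x_ny_n|\bar x_{n-1}\bar y_{n-1})=M_{\mathcal Y}(y_n|\bar y_{n-1})$ for all $y_n$. Put $$\mathbb W_\gamma(M_{\mathcal X},M_{\mathcal Y};c,x_0,y_0)=\inf_{M\text{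 bicausal}}\int\sum_{t\ge0}\gamma^t c(X_t,Y_t)\,\mathrm dM .$$ **Transition couplings.** A transition coupling is a map $\pi$ from $\mathcal X\times\mathcal Y$ to probability distributions on $\mathcal X\times\mathcal Y$; it is *valid* if each $\pi(\cdot|xy)$ is a coupling of $P_{\mathcal X}(\cdot|x)$ and $P_{\mathcal Y}(\cdot|y)$. For the chain $(X_t,Y_t)$ with kernel $\pi$ let $V^\pi(xy)=\mathbb E_\pi[\sum_{t\ge0}\gamma^tc(X_t,Y_t)\mid (X_0,Y_0)=(x,y)]$ and, started at $(x_0,y_0)$, $$\mu^\pi(xy,x'y')=(1-\gamma)\,\mathbb E_\pi\Big[\sum_{t\ge0}\gamma^t\mathbf 1\{(X_t,Y_t)=(x,y),(X_{t+1},Y_{t+1})=(x',y')\}\Big].$$ For a nonnegative function $\mu$ on pairs of joint states let $\pi_\mu(x'y'|xy)=\mu(xy,x'y')/\sum_{x''y''}\mu(xy,x''y'')$ if the denominator is nonzero, and $\pi_\mu(x'y'|xy)=P_{\mathcal X}(x'|x)P_{\mathcal Y}(y'|y)$ otherwise. **Rounding.** For a nonnegative matrix $F\in\mathbb R^{\mathcal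 X\times\mathcal Y}$ and distributions $p$ on $\mathcal X$, $q$ on $\mathcal Y$, let $F'_{xy}=\min\big(p_x/\sum_{y'}F_{xy'},1\big)F_{xy}$, $F''_{xy}=F'_{xy}\min\big(q_y/\sum_{x'}F'_{x'y},1\big)$, $e^p_x=p_x-\sum_yF''_{xy}$, $e^q_y=q_y-\sum_xF''_{xy}$, and $\rho(F,p,q)=F''+e^p(e^q)^{\mathsf T}/\|e^p\|_1$ (the last term being $0$ if $e^p=0$; zero rows or columns stay zero under the scalings). For a transition coupling $\pi$ let $\rho(\pi)(\cdot|xy)=\rho\big(\pi(\cdot|xy),P_{\mathcal X}(\cdot|x),P_{\mathcal Y}(\cdot|y)\big)$. **Sinkhorn Policy Iteration** with $K\ge1$ steps and parameter $\eta$, from the uniform coupling $\pi_1(x'y'|xy)=\frac1{|\mathcal X||\mathcal Y|}$: for $k=1,\dots,K-1$, let $\tilde\pi_k=\rho(\pi_k)$, let $Q_k$ solve $$Q_k(xy,x'y')=c(xy)+\gamma\sum_{x''y''}\tilde\pi_k(x''y''|x'y')\,Q_k(x'y',x''y''),$$ and put, for $k$ odd, $$\pi_{k+1}(x'y'|xy)=\frac{\pi_k(x'y'|xy)\,e^{-\eta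 Q_k(xy,x'y')}}{\sum_{y''}\pi_k(x'y''|xy)\,e^{-\eta Q_k(xy,x'y'')}}\,P_{\mathcal X}(x'|x),$$ and for $k$ even, $$\pi_{k+1}(x'y'|xy)=\frac{\pi_k(x'y'|xy)\,e^{-\eta Q_k(xy,x'y')}}{\sum_{x''}\pi_k(x''y'|xy)\,e^{-\eta Q_k(xy,x''y')}}\,P_{\mathcal Y}(y'|y)$$ (an entry whose denominator vanishes is $0$). The output is $\pi_{\mathrm{out}}=\pi_{\mu_{\mathrm{out}}}$ with $\mu_{\mathrm{out}}=\frac1K\sum_{k=1}^K\mu^{\tilde\pi_k}$, where $\tilde\pi_K=\rho(\pi_K)$. **Theorem.** Let $\varepsilon>0$ and suppose Sinkhorn Policy Iteration is run from the uniform coupling for $K\ge1$ steps with $$\eta=\frac{1-\gamma}{3\|c\|_\infty}\sqrt{\frac{8\log(|\mathcal X||\mathcal Y|)}{K}}$$ ($\eta=0$ if $c=0$). If $$K\ \ge\ \frac{5\,\|c\|_\infty^2\log(|\mathcal X||\mathcal Y|)}{(1-\gamma)^4\varepsilon^2},$$ then, for all $x_0\in\mathcal X$ and $y_0\in\mathcal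 Y$, $\pi_{\mathrm{out}}$ is a valid transition coupling and $$V^{\pi_{\mathrm{out}}}(x_0y_0)\ \le\ \mathbb W_\gamma(M_{\mathcal X},M_{\mathcal Y};c,x_0,y_0)+\varepsilon .$$ -/

import Mathlib

open MeasureTheory ProbabilityTheory

noncomputable section

namespace MarkovOT

/-! ### Markov chains on a finite state space

Throughout, a transition matrix on a finite set `S` is a function `P : S → S → ℝ`, where `P s z`
is the probability `P(z | s)` of moving from `s` to `z`; it is stochastic when every row lies in
the probability simplex `stdSimplex ℝ S`. -/

section Chain

variable {S : Type*} [Fintype S] [MeasurableSpace S] [DiscreteMeasurableSpace S]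

open Classical in
/-- One step from the state `s`: the probability measure on `S` with point masses `P s z`. If the
row `P s` is not a probability vector (a case of no interest), the chain stays at `s`, which makes
`stepMeasure` a probability measure for every `P`. -/
def stepMeasure (P : S → S → ℝ) (s : S) : Measure S :=
  if P s ∈ stdSimplex ℝ S then ∑ z, ENNReal.ofReal (P s z) • Measure.dirac z
  else Measure.dirac s

theorem isProbabilityMeasure_stepMeasure (P : S → S → ℝ) (s : S) :
    IsProbabilityMeasure (stepMeasure P s) := by
  unfold stepMeasure
  split_ifs with h
  · constructor
    simp only [Measure.coe_finsetSum, Measure.coe_smul, Finset.sum_apply, Pi.smul_apply,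
      measure_univ, smul_eq_mul, mul_one]
    rw [← ENNReal.ofReal_sum_of_nonneg (fun z _ => h.1 z), h.2, ENNReal.ofReal_one]
  · infer_instance

/-- The transition kernel at time `n`, as a kernel from the history `(s_0, …, s_n)`; it only uses
the last state. -/
def stepKernel (P : S → S → ℝ) (n : ℕ) : Kernel ((i : Finset.Iic n) → S) S where
  toFun h := stepMeasure P (h ⟨n, Finset.mem_Iic.mpr le_rfl⟩)
  measurable' := (measurable_of_countable (stepMeasure P)).comp (measurable_pi_apply _)

instance (P : S → S → ℝ) (n : ℕ) : IsMarkovKernel (stepKernel P n) :=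
  ⟨fun _ => isProbabilityMeasure_stepMeasure P _⟩

/-- The law, on the space of infinite sequences `(s_0, s_1, …)`, of the Markov chain with
transition matrix `P` started at `s₀`, obtained from the Ionescu-Tulcea extension theorem. -/
def chainLaw (P : S → S → ℝ) (s₀ : S) : Measure (ℕ → S) :=
  Kernel.traj (X := fun _ => S) (stepKernel P) 0 (fun _ => s₀)

/-- The set of sequences that agree with `ω` at the times `0, …, n`. -/
def cyl (ω : ℕ → S) (n : ℕ) : Set (ℕ → S) := {ω' | ∀ i ≤ n, ω' i = ω i}

end Chain

/-- The discounted total cost `∑ₜ γᵗ c(sₜ)` of a sequence. -/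
def discountedCost {S : Type*} (γ : ℝ) (c : S → ℝ) (ω : ℕ → S) : ℝ := ∑' t, γ ^ t * c (ω t)

section Transport

variable {X Y : Type*} [Fintype X] [Fintype Y]
  [MeasurableSpace X] [MeasurableSpace Y] [DiscreteMeasurableSpace X] [DiscreteMeasurableSpace Y]

/-- `M` is a bicausal coupling of the laws of the Markov chains `(PX, x₀)` and `(PY, y₀)`: it is a
coupling of the two laws and, conditionally on any joint history of positive probability, the next
state of each coordinate is distributed as under that chain alone given its own history. -/
structure IsBicausalCoupling (PX : X → X → ℝ) (PY : Y → Y → ℝ) (x₀ : X) (y₀ : Y)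
    (M : Measure (ℕ → X × Y)) : Prop where
  isProbabilityMeasure : IsProbabilityMeasure M
  map_fst : M.map (fun ω n => (ω n).1) = chainLaw PX x₀
  map_snd : M.map (fun ω n => (ω n).2) = chainLaw PY y₀
  causal_fst : ∀ (ω : ℕ → X × Y) (n : ℕ), M (cyl ω n) ≠ 0 → ∀ x' : X,
    M[{ω' | (ω' (n + 1)).1 = x'} | cyl ω n] =
      (chainLaw PX x₀)[{ξ | ξ (n + 1) = x'} | cyl (fun i => (ω i).1) n]
  causal_snd : ∀ (ω : ℕ → X × Y) (n : ℕ), M (cyl ω n) ≠ 0 → ∀ y' : Y,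
    M[{ω' | (ω' (n + 1)).2 = y'} | cyl ω n] =
      (chainLaw PY y₀)[{ζ | ζ (n + 1) = y'} | cyl (fun i => (ω i).2) n]

/-- The bicausal optimal transport distance `𝕎_γ(M_X, M_Y; c, x₀, y₀)`. -/
def otDist (γ : ℝ) (PX : X → X → ℝ) (PY : Y → Y → ℝ) (c : X × Y → ℝ) (x₀ : X) (y₀ : Y) : ℝ :=
  sInf {r | ∃ M : Measure (ℕ → X × Y), IsBicausalCoupling PX PY x₀ y₀ M ∧
    r = ∫ ω, discountedCost γ c ω ∂M}

/-- The value function `V^π(xy) = 𝔼[∑ₜ γᵗ c(Xₜ, Yₜ) | (X₀, Y₀) = xy]` of a transition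
coupling `π`. -/
def value (γ : ℝ) (c : X × Y → ℝ) (π : X × Y → X × Y → ℝ) (s : X × Y) : ℝ :=
  ∫ ω, discountedCost γ c ω ∂(chainLaw π s)

/-- The occupancy coupling
`μ^π(s, z) = (1 - γ) 𝔼[∑ₜ γᵗ 𝟙{(Xₜ, Yₜ) = s, (Xₜ₊₁, Yₜ₊₁) = z}]`, with initial state pair `s₀`. -/
def occupancy (γ : ℝ) (π : X × Y → X × Y → ℝ) (s₀ : X × Y) (s z : X × Y) : ℝ :=
  (1 - γ) * ∫ ω, ∑' t : ℕ,
    Set.indicator {ω' : ℕ → X × Y | ω' t = s ∧ ω' (t + 1) = z} (fun _ => γ ^ t) ω ∂(chainLaw π s₀)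

end Transport

/-! ### Sinkhorn Policy Iteration -/

section Algorithm

variable {X Y : Type*} [Fintype X] [Fintype Y]

/-- The valid couplings of two distributions `p` and `q`. -/
def couplings (p : X → ℝ) (q : Y → ℝ) : Set (X × Y → ℝ) :=
  {F | F ∈ stdSimplex ℝ (X × Y) ∧ (∀ x, ∑ y, F (x, y) = p x) ∧ (∀ y, ∑ x, F (x, y) = q y)}

/-- A transition coupling is valid if each `π(· | xy)` couples `PX(· | x)` and `PY(· | y)`. -/
def IsValid (PX : X → X → ℝ) (PY : Y → Y → ℝ) (π : X × Y → X × Y → ℝ) : Prop :=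
  ∀ s, π s ∈ couplings (PX s.1) (PY s.2)

/-- First stage of the rounding procedure: rows with too much mass are scaled down. (When a row of
`F` vanishes its scaling factor is irrelevant.) -/
def scaleRows (p : X → ℝ) (F : X × Y → ℝ) (z : X × Y) : ℝ :=
  min (p z.1 / ∑ y, F (z.1, y)) 1 * F z

/-- Second stage of the rounding procedure: columns with too much mass are scaled down. -/
def scaleCols (q : Y → ℝ) (F : X × Y → ℝ) (z : X × Y) : ℝ :=
  F z * min (q z.2 / ∑ x, F (x, z.2)) 1

/-- The rounding procedure `ρ(F, p, q)` of Altschuler, Weed and Rigollet: scale the rows, scale the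
columns, then distribute the missing mass by a rank-one term (which is zero when no mass is
missing, in accordance with `a / 0 = 0`). -/
def roundMatrix (p : X → ℝ) (q : Y → ℝ) (F : X × Y → ℝ) (z : X × Y) : ℝ :=
  let G := scaleCols q (scaleRows p F)
  let errp : X → ℝ := fun x => p x - ∑ y, G (x, y)
  let errq : Y → ℝ := fun y => q y - ∑ x, G (x, y)
  G z + errp z.1 * errq z.2 / ∑ x, |errp x|

/-- The rounded transition coupling `ρ(π)`, obtained by rounding `π(· | xy)` for each `xy`. -/
def roundCoupling (PX : X → X → ℝ) (PY : Y → Y → ℝ) (π : X × Y → X × Y → ℝ) (s : X × Y) :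
    X × Y → ℝ :=
  roundMatrix (PX s.1) (PY s.2) (π s)

/-- The Bellman operator `(𝒯^π f)(s, z) = c(s) + γ ∑_w π(w | z) f(z, w)`. -/
def bellman (γ : ℝ) (c : X × Y → ℝ) (π f : X × Y → X × Y → ℝ) (s z : X × Y) : ℝ :=
  c s + γ * ∑ w, π z w * f z w

/-- The multiplicative update of odd rounds, which restores the `X`-marginals. (A denominator can
only vanish in a row with `PX(x' | x) = 0`, where the updated entry is `0`.) -/
def updateX (PX : X → X → ℝ) (η : ℝ) (π Q : X × Y → X × Y → ℝ) (s z : X × Y) : ℝ :=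
  π s z * Real.exp (-η * Q s z) / (∑ y, π s (z.1, y) * Real.exp (-η * Q s (z.1, y))) * PX s.1 z.1

/-- The multiplicative update of even rounds, which restores the `Y`-marginals. -/
def updateY (PY : Y → Y → ℝ) (η : ℝ) (π Q : X × Y → X × Y → ℝ) (s z : X × Y) : ℝ :=
  π s z * Real.exp (-η * Q s z) / (∑ x, π s (x, z.2) * Real.exp (-η * Q s (x, z.2))) * PY s.2 z.2

/-- `π 1, …, π K` and `Q 1, …, Q (K - 1)` are the iterates of Sinkhorn Policy Iteration with `K`
steps, regularization parameter `η` and initial transition coupling `π₁`: in each round, `Q k`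
solves the Bellman equations of the rounded transition coupling `ρ(π k)`, and `π (k + 1)` is the
multiplicative update of `π k`. -/
structure IsSPIRun (PX : X → X → ℝ) (PY : Y → Y → ℝ) (c : X × Y → ℝ) (γ η : ℝ) (K : ℕ)
    (π₁ : X × Y → X × Y → ℝ) (π Q : ℕ → X × Y → X × Y → ℝ) : Prop where
  init : π 1 = π₁
  evaluate : ∀ k, 1 ≤ k → k < K → Q k = bellman γ c (roundCoupling PX PY (π k)) (Q k)
  update_odd : ∀ k, 1 ≤ k → k < K → Odd k → π (k + 1) = updateX PX η (π k) (Q k)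
  update_even : ∀ k, 1 ≤ k → k < K → Even k → π (k + 1) = updateY PY η (π k) (Q k)

/-- The uniform transition coupling. -/
def uniformCoupling (X Y : Type*) [Fintype X] [Fintype Y] : X × Y → X × Y → ℝ :=
  fun _ _ => 1 / ((Fintype.card X : ℝ) * Fintype.card Y)

open Classical in
/-- The transition coupling `π_μ` extracted from a joint distribution `μ` on pairs of states. -/
def extract (PX : X → X → ℝ) (PY : Y → Y → ℝ) (μ : X × Y → X × Y → ℝ) (s z : X × Y) : ℝ :=
  if ∑ w, μ s w ≠ 0 then μ s z / ∑ w, μ s w else PX s.1 z.1 * PY s.2 z.2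

/-- The output `π_out` of Sinkhorn Policy Iteration: the transition coupling extracted from the
average of the occupancy couplings of the rounded iterates `ρ(π 1), …, ρ(π K)`. -/
def spiOutput [MeasurableSpace X] [MeasurableSpace Y] [DiscreteMeasurableSpace X]
    [DiscreteMeasurableSpace Y] (PX : X → X → ℝ) (PY : Y → Y → ℝ) (γ : ℝ) (K : ℕ) (s₀ : X × Y)
    (π : ℕ → X × Y → X × Y → ℝ) : X × Y → X × Y → ℝ :=
  extract PX PY fun s z =>
    (1 / (K : ℝ)) * ∑ k ∈ Finset.Icc 1 K, occupancy γ (roundCoupling PX PY (π k)) s₀ s z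

end Algorithm

end MarkovOT

end

noncomputable section

set_option linter.unusedSectionVars false

namespace MarkovOT

/-! ### Laws of Markov chains on cylinders. -/

section ChainLaw

variable {S : Type*} [Fintype S] [MeasurableSpace S] [DiscreteMeasurableSpace S]

/-! The algorithm is entropic mirror descent run in parallel at all joint states, except that each
update restores only one marginal and the losses `Q k` come from the rounded iterates.

The cost of a bicausal coupling `M` depends only on its discounted occupancies, and bicausality
makes the pair occupancy factor as d(s) G(z|s) with `G` a valid transition coupling
(`IsBicausalCoupling.exists_isValid`). Flow constraints are linear, so the value of the output is
the average of the values W_k of the rounded iterates (`IsSPIRun.isValid_spiOutput`). By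
`performance_difference`, (1 - γ)(W_k(s₀) - cost of M) is the d-average of ⟨ρ(π_k) - G, Q_k⟩. It
remains to bound the regret against `G` at each state (`sinkhorn_regret`).

In one round let F be the iterate, R its rounding, g = ηQ with values in [0, h], h = η‖c‖/(1 - γ),
and let p be the marginal being restored. The relative entropy of `G` drops by KL(p, T) - ⟨G, g⟩,
where T is the marginal of F exp(-g). The Gibbs variational inequality with a free potential f,
followed by Hoeffding's lemma, gives ⟨F, g⟩ + ⟨F, f⟩ - ⟨p, f⟩ ≤ KL(p, T) + b²/8, where g + f has
values in [0, b]. Take f = h on the fibres where F has too much mass: the extra terms pay for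
replacing F by R, while b only grows from h to 2h (`mirror_round`). The entropies telescope,
starting from at most log(|X||Y|). The uniform start respects neither marginal and costs one
additional h. `le_of_regret_bound` then inserts η and K. -/

instance (P : S → S → ℝ) (s₀ : S) : IsProbabilityMeasure (chainLaw P s₀) := by
  unfold chainLaw; infer_instance

theorem stepMeasure_singleton {P : S → S → ℝ} {s : S} (h : P s ∈ stdSimplex ℝ S) (z : S) :
    stepMeasure P s {z} = ENNReal.ofReal (P s z) := by
  classical
  rw [stepMeasure, if_pos h]
  simp only [Measure.coe_finsetSum, Measure.coe_smul, Finset.sum_apply, Pi.smul_apply,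
    smul_eq_mul, Measure.dirac_apply, Set.indicator_apply, Set.mem_singleton_iff, Pi.one_apply,
    mul_ite, mul_one, mul_zero]
  rw [Finset.sum_ite_eq' Finset.univ z]
  simp

theorem cyl_eq_preimage (ω : ℕ → S) (n : ℕ) :
    cyl ω n = Preorder.frestrictLe (π := fun _ => S) n ⁻¹' {Preorder.frestrictLe n ω} := by
  ext ω'
  simp only [cyl, Set.mem_ofPred_eq, Set.mem_preimage, Set.mem_singleton_iff, funext_iff,
    Preorder.frestrictLe_apply, Subtype.forall, Finset.mem_Iic]

theorem measurableSet_cyl (ω : ℕ → S) (n : ℕ) : MeasurableSet (cyl ω n) := by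
  rw [cyl_eq_preimage]
  exact (Preorder.measurable_frestrictLe n) (measurableSet_singleton _)

theorem chainLaw_zero (P : S → S → ℝ) (s₀ : S) : chainLaw P s₀ {ω | ω 0 = s₀} = 1 := by
  have h := Kernel.traj_map_frestrictLe_apply (X := fun _ => S) (κ := stepKernel P) 0 0
    (fun _ => s₀)
  rw [Kernel.partialTraj_self, Kernel.id_apply] at h
  have h2 := congrArg (fun m => m {g | g ⟨0, by simp⟩ = s₀}) h
  have hm : MeasurableSet {g : (i : Finset.Iic 0) → S | g ⟨0, by simp⟩ = s₀} :=
    measurableSet_eq_fun (measurable_pi_apply _) measurable_const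
  rw [Measure.map_apply (Preorder.measurable_frestrictLe 0) hm, Measure.dirac_apply' _ hm] at h2
  simpa [chainLaw] using h2

/-- The joint law of the history up to `n` and the next state is the composition product of the
partial trajectory with a step kernel that reads only the last state. -/
theorem chainLaw_cyl_inter {P : S → S → ℝ} (hP : ∀ s, P s ∈ stdSimplex ℝ S) (s₀ : S)
    (ω : ℕ → S) (n : ℕ) (z : S) :
    chainLaw P s₀ (cyl ω n ∩ {ω' | ω' (n + 1) = z}) =
      chainLaw P s₀ (cyl ω n) * ENNReal.ofReal (P (ω n) z) := by
  have h := Kernel.partialTraj_compProd_eq_map_traj (X := fun _ => S) (κ := stepKernel P)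
    (Nat.zero_le n) (x₀ := fun _ => s₀)
  have h2 := congrArg (fun m => m ({Preorder.frestrictLe (π := fun _ => S) n ω} ×ˢ {z})) h
  rw [Measure.map_apply ((Preorder.measurable_frestrictLe n).prodMk (measurable_pi_apply _))
      ((measurableSet_singleton _).prod (measurableSet_singleton z)),
    Measure.compProd_apply_prod (measurableSet_singleton _) (measurableSet_singleton z),
    lintegral_singleton, ← Kernel.traj_map_frestrictLe_apply,
    Measure.map_apply (Preorder.measurable_frestrictLe n) (measurableSet_singleton _),
    ← cyl_eq_preimage, mul_comm] at h2
  have h3 : stepKernel P n (Preorder.frestrictLe n ω) {z} = ENNReal.ofReal (P (ω n) z) :=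
    stepMeasure_singleton (hP _) z
  rw [h3] at h2
  refine Eq.trans ?_ h2.symm
  rw [cyl_eq_preimage]
  rfl

/-- If, given every history, the image under `φ` of the next state has conditional distribution
`p (ω n)`, then the same holds given only the present state. -/
theorem measure_step_of_cyl {I : Type*} (M : Measure (ℕ → S)) (φ : S → I) (p : S → I → ℝ)
    (i : I)
    (h : ∀ ω n, M (cyl ω n ∩ {ω' | φ (ω' (n + 1)) = i}) = M (cyl ω n) * ENNReal.ofReal (p (ω n) i))
    (n : ℕ) (s : S) :
    M {ω | ω n = s ∧ φ (ω (n + 1)) = i} = M {ω | ω n = s} * ENNReal.ofReal (p s i) := by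
  classical
  have hdec : ∀ A : Set (ℕ → S), MeasurableSet A →
      M A = ∑ g : (i : Finset.Iic n) → S, M (A ∩ Preorder.frestrictLe n ⁻¹' {g}) := by
    intro A hA
    have : A = ⋃ g ∈ (Finset.univ : Finset ((i : Finset.Iic n) → S)),
        A ∩ Preorder.frestrictLe (π := fun _ => S) n ⁻¹' {g} := by
      ext; simp
    conv_lhs => rw [this]
    refine measure_biUnion_finset ?_ fun g _ =>
      hA.inter ((Preorder.measurable_frestrictLe n) (measurableSet_singleton g))
    intro g _ g' _ hne
    refine Set.disjoint_left.2 fun ω h1 h2 => hne ?_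
    exact h1.2.symm.trans h2.2
  have hs : MeasurableSet {ω : ℕ → S | ω n = s} :=
    measurableSet_eq_fun (measurable_pi_apply n) measurable_const
  have hi : MeasurableSet {ω : ℕ → S | φ (ω (n + 1)) = i} :=
    (MeasurableSet.of_discrete (s := φ ⁻¹' {i})).preimage
      (measurable_pi_apply (n + 1) : Measurable fun ω : ℕ → S => ω (n + 1))
  rw [hdec _ hs, hdec {ω | ω n = s ∧ φ (ω (n + 1)) = i} (hs.inter hi), Finset.sum_mul]
  refine Finset.sum_congr rfl fun g _ => ?_
  -- The hypothesis speaks of cylinders, so the history `g` is extended to a sequence; its values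
  -- after time `n` play no role.
  let ω : ℕ → S := fun k => if hk : k ≤ n then g ⟨k, Finset.mem_Iic.2 hk⟩ else s
  have hω : Preorder.frestrictLe n ω = g := by
    ext k
    have := Finset.mem_Iic.1 k.2
    simp [ω, this]
  have hc := cyl_eq_preimage ω n
  rw [hω] at hc
  rw [← hc]
  by_cases hsn : ω n = s
  · have e1 : {ω' : ℕ → S | ω' n = s} ∩ cyl ω n = cyl ω n :=
      Set.inter_eq_right.2 fun ω' h' => (h' n le_rfl).trans hsn
    have e2 : {ω' : ℕ → S | ω' n = s ∧ φ (ω' (n + 1)) = i} ∩ cyl ω n =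
        cyl ω n ∩ {ω' | φ (ω' (n + 1)) = i} := by
      ext ω'
      constructor
      · exact fun h' => ⟨h'.2, h'.1.2⟩
      · exact fun h' => ⟨⟨(h'.1 n le_rfl).trans hsn, h'.2⟩, h'.1⟩
    rw [e1, e2, h, hsn]
  · have e1 : {ω' : ℕ → S | ω' n = s} ∩ cyl ω n = ∅ := by
      ext ω'
      simp only [Set.mem_inter_iff, Set.mem_ofPred_eq, Set.mem_empty_iff_false, iff_false]
      exact fun h' => hsn ((h'.2 n le_rfl).symm.trans h'.1)
    have e2 : {ω' : ℕ → S | ω' n = s ∧ φ (ω' (n + 1)) = i} ∩ cyl ω n = ∅ := by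
      ext ω'
      simp only [Set.mem_inter_iff, Set.mem_ofPred_eq, Set.mem_empty_iff_false, iff_false]
      exact fun h' => hsn ((h'.2 n le_rfl).symm.trans h'.1.1)
    rw [e1, e2]; simp

end ChainLaw

/-! ### Discounted occupancy measures and flow constraints. -/

section Occupancy

variable {S : Type*} [Fintype S] [MeasurableSpace S] [DiscreteMeasurableSpace S]

/-- The discounted occupancy measure of states under the law `M`. -/
def stateOcc (γ : ℝ) (M : Measure (ℕ → S)) (s : S) : ℝ :=
  (1 - γ) * ∑' t : ℕ, γ ^ t * M.real {ω | ω t = s}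

/-- The discounted occupancy measure of pairs of consecutive states under the law `M`. -/
def pairOcc (γ : ℝ) (M : Measure (ℕ → S)) (s z : S) : ℝ :=
  (1 - γ) * ∑' t : ℕ, γ ^ t * M.real {ω | ω t = s ∧ ω (t + 1) = z}

theorem measurableSet_state (t : ℕ) (s : S) : MeasurableSet {ω : ℕ → S | ω t = s} :=
  measurableSet_eq_fun (measurable_pi_apply t) measurable_const

theorem integral_tsum_discounted {Ω : Type*} [MeasurableSpace Ω] (μ : Measure Ω)
    [IsProbabilityMeasure μ] {γ : ℝ} (hγ₀ : 0 < γ) (hγ₁ : γ < 1) (f : ℕ → Ω → ℝ) (B : ℝ)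
    (hf : ∀ t, Measurable (f t)) (hB : ∀ t ω, |f t ω| ≤ B) :
    ∫ ω, ∑' t, γ ^ t * f t ω ∂μ = ∑' t, γ ^ t * ∫ ω, f t ω ∂μ := by
  have hint : ∀ t, Integrable (fun ω => γ ^ t * f t ω) μ := fun t =>
    (Integrable.of_bound (hf t).aestronglyMeasurable B (ae_of_all _ (hB t))).const_mul _
  rw [← integral_tsum_of_summable_integral_norm hint]
  · simp_rw [integral_const_mul]
  · refine Summable.of_nonneg_of_le (fun t => integral_nonneg fun ω => norm_nonneg _)
      (fun t => ?_) ((summable_geometric_of_lt_one hγ₀.le hγ₁).mul_right B)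
    calc ∫ ω, ‖γ ^ t * f t ω‖ ∂μ ≤ ∫ _, γ ^ t * B ∂μ := by
          refine integral_mono (hint t).norm (integrable_const _) fun ω => ?_
          simp only [Real.norm_eq_abs, abs_mul, abs_of_pos (pow_pos hγ₀ t)]
          exact mul_le_mul_of_nonneg_left (hB t ω) (pow_pos hγ₀ t).le
      _ = γ ^ t * B := by simp

variable {γ : ℝ} (hγ₀ : 0 < γ) (hγ₁ : γ < 1) (M : Measure (ℕ → S)) [IsProbabilityMeasure M]
include hγ₀ hγ₁

theorem summable_discounted_measureReal (A : ℕ → Set (ℕ → S)) :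
    Summable fun t => γ ^ t * M.real (A t) :=
  Summable.of_nonneg_of_le (fun t => mul_nonneg (pow_pos hγ₀ t).le measureReal_nonneg)
    (fun t => mul_le_of_le_one_right (pow_pos hγ₀ t).le measureReal_le_one)
    (summable_geometric_of_lt_one hγ₀.le hγ₁)

theorem stateOcc_nonneg (s : S) : 0 ≤ stateOcc γ M s :=
  mul_nonneg (by linarith) (tsum_nonneg fun t => mul_nonneg (pow_pos hγ₀ t).le measureReal_nonneg)

theorem pairOcc_nonneg (s z : S) : 0 ≤ pairOcc γ M s z :=
  mul_nonneg (by linarith) (tsum_nonneg fun t => mul_nonneg (pow_pos hγ₀ t).le measureReal_nonneg)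

theorem sum_measureReal_inter (t : ℕ) (A : Set (ℕ → S)) (hA : MeasurableSet A) :
    ∑ s, M.real (A ∩ {ω | ω t = s}) = M.real A := by
  classical
  have : A = ⋃ s ∈ (Finset.univ : Finset S), A ∩ {ω | ω t = s} := by ext; simp
  conv_rhs => rw [this]
  rw [measureReal_biUnion_finset _ fun s _ => hA.inter (measurableSet_state t s)]
  intro s _ s' _ hne
  exact Set.disjoint_left.2 fun ω h1 h2 => hne (h1.2.symm.trans h2.2)

theorem sum_stateOcc : ∑ s, stateOcc γ M s = 1 := by
  unfold stateOcc
  rw [← Finset.mul_sum, ← Summable.tsum_finsetSum fun s _ =>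
    summable_discounted_measureReal hγ₀ hγ₁ M _]
  have : ∀ t : ℕ, ∑ s, γ ^ t * M.real {ω | ω t = s} = γ ^ t := fun t => by
    have h := sum_measureReal_inter hγ₀ hγ₁ M t Set.univ MeasurableSet.univ
    simp only [Set.univ_inter, probReal_univ] at h
    rw [← Finset.mul_sum, h, mul_one]
  simp_rw [this]
  rw [tsum_geometric_of_lt_one hγ₀.le hγ₁]
  exact mul_inv_cancel₀ (by linarith)

theorem sum_pairOcc (s : S) : ∑ z, pairOcc γ M s z = stateOcc γ M s := by
  unfold pairOcc stateOcc
  rw [← Finset.mul_sum, ← Summable.tsum_finsetSum fun s _ =>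
    summable_discounted_measureReal hγ₀ hγ₁ M _]
  simp_rw [← Finset.mul_sum]
  congr! 4 with t
  exact sum_measureReal_inter hγ₀ hγ₁ M (t + 1) _ (measurableSet_state t s)

/-- Splitting off time zero leaves the arrivals from a predecessor, which occur one step later and
so carry one more factor `γ`. -/
theorem flow_pairOcc (z : S) :
    stateOcc γ M z = (1 - γ) * M.real {ω | ω 0 = z} + γ * ∑ s, pairOcc γ M s z := by
  unfold pairOcc stateOcc
  rw [← Finset.mul_sum, ← Summable.tsum_finsetSum fun s _ =>
    summable_discounted_measureReal hγ₀ hγ₁ M _]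
  simp_rw [← Finset.mul_sum]
  rw [(summable_discounted_measureReal hγ₀ hγ₁ M _).tsum_eq_zero_add]
  have : ∀ t : ℕ, ∑ s, M.real {ω | ω t = s ∧ ω (t + 1) = z} = M.real {ω | ω (t + 1) = z} :=
    fun t => by
      rw [← sum_measureReal_inter hγ₀ hγ₁ M t _ (measurableSet_state (t + 1) z)]
      refine Finset.sum_congr rfl fun s _ => ?_
      rw [Set.inter_comm]; rfl
  simp_rw [this, pow_succ', mul_assoc, tsum_mul_left]
  ring

theorem integral_discountedCost (c : S → ℝ) :
    (1 - γ) * ∫ ω, discountedCost γ c ω ∂M = ∑ s, stateOcc γ M s * c s := by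
  unfold discountedCost stateOcc
  rw [integral_tsum_discounted M hγ₀ hγ₁ (fun t ω => c (ω t)) ‖c‖
    (fun t => (measurable_of_countable c).comp (measurable_pi_apply t))
    (fun t ω => norm_le_pi_norm c (ω t))]
  have : ∀ t : ℕ, ∫ ω, c (ω t) ∂M = ∑ s, M.real {ω | ω t = s} * c s := fun t => by
    rw [← integral_map (φ := fun ω : ℕ → S => ω t) (measurable_pi_apply t).aemeasurable
      (measurable_of_countable c).aestronglyMeasurable, integral_fintype]
    · refine Finset.sum_congr rfl fun s _ => ?_
      rw [map_measureReal_apply (measurable_pi_apply t) (measurableSet_singleton s), smul_eq_mul]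
      rfl
    · have := Measure.isProbabilityMeasure_map (μ := M) (f := fun ω : ℕ → S => ω t)
        (measurable_pi_apply t).aemeasurable
      exact Integrable.of_finite
  simp_rw [this, Finset.mul_sum, ← mul_assoc]
  rw [Summable.tsum_finsetSum fun s _ =>
    (summable_discounted_measureReal hγ₀ hγ₁ M _).mul_right _, Finset.mul_sum]
  refine Finset.sum_congr rfl fun s _ => ?_
  rw [tsum_mul_right, mul_assoc]

/-- The pair occupancy measure of a process whose next state has image under `φ` distributed as
`p`. -/
theorem sum_fiber_pairOcc {I : Type*} [DecidableEq I] (φ : S → I) (p : S → I → ℝ)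
    (hp : ∀ s i, 0 ≤ p s i)
    (h : ∀ i ω n, M (cyl ω n ∩ {ω' | φ (ω' (n + 1)) = i}) =
      M (cyl ω n) * ENNReal.ofReal (p (ω n) i)) (s : S) (i : I) :
    ∑ z with φ z = i, pairOcc γ M s z = stateOcc γ M s * p s i := by
  unfold pairOcc stateOcc
  rw [← Finset.mul_sum, ← Summable.tsum_finsetSum fun s _ =>
    summable_discounted_measureReal hγ₀ hγ₁ M _, mul_assoc, ← tsum_mul_right]
  congr 2 with t
  have h1 := measure_step_of_cyl M φ p i (h i) t s
  have h2 := congrArg ENNReal.toReal h1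
  rw [ENNReal.toReal_mul, ENNReal.toReal_ofReal (hp s i)] at h2
  rw [← Finset.mul_sum, mul_assoc]
  congr 1
  refine Eq.trans ?_ h2
  change _ = M.real _
  have : {ω : ℕ → S | ω t = s ∧ φ (ω (t + 1)) = i} =
      ⋃ z ∈ (Finset.univ.filter fun z => φ z = i), {ω | ω t = s ∧ ω (t + 1) = z} := by
    ext; simp [and_comm]
  rw [this, measureReal_biUnion_finset]
  · intro z _ z' _ hne
    exact Set.disjoint_left.2 fun ω h1 h2 => hne (h1.2.symm.trans h2.2)
  · exact fun z _ => (measurableSet_state t s).inter (measurableSet_state (t + 1) z)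

omit M [IsProbabilityMeasure M]

theorem pairOcc_chainLaw {P : S → S → ℝ} (hP : ∀ s, P s ∈ stdSimplex ℝ S) (s₀ s z : S) :
    pairOcc γ (chainLaw P s₀) s z = stateOcc γ (chainLaw P s₀) s * P s z := by
  classical
  have := sum_fiber_pairOcc hγ₀ hγ₁ (chainLaw P s₀) id P (fun s z => (hP s).1 z)
    (fun i ω n => chainLaw_cyl_inter hP s₀ ω n i) s z
  simpa [Finset.sum_filter] using this

/-- No Markov property is used, so this serves bicausal couplings as well as chains. -/
theorem flow_dot (M : Measure (ℕ → S)) [IsProbabilityMeasure M] {s₀ : S}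
    (hM : M {ω | ω 0 = s₀} = 1) (W : S → ℝ) :
    ∑ z, stateOcc γ M z * W z =
      (1 - γ) * W s₀ + γ * ∑ s, ∑ z, pairOcc γ M s z * W z := by
  classical
  have h0 : ∀ z, M.real {ω | ω 0 = z} = if z = s₀ then 1 else 0 := fun z => by
    split_ifs with h
    · rw [h, measureReal_def, hM, ENNReal.toReal_one]
    · have h1 : M {ω | ω 0 = s₀}ᶜ = 0 := (prob_compl_eq_zero_iff (measurableSet_state 0 s₀)).2 hM
      rw [measureReal_def, measure_mono_null _ h1, ENNReal.toReal_zero]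
      intro ω hω hs
      exact h (hω.symm.trans hs)
  have h1 : ∀ z, stateOcc γ M z * W z = (1 - γ) * (if z = s₀ then W z else 0)
      + γ * ∑ s, pairOcc γ M s z * W z := fun z => by
    rw [flow_pairOcc hγ₀ hγ₁ M z, h0, ← Finset.sum_mul]
    split_ifs <;> ring
  simp_rw [h1]
  rw [Finset.sum_add_distrib, ← Finset.mul_sum, ← Finset.mul_sum, Finset.sum_comm]
  simp

end Occupancy

theorem occupancy_eq_pairOcc {X Y : Type*} [Fintype X] [Fintype Y]
    [MeasurableSpace X] [MeasurableSpace Y] [DiscreteMeasurableSpace X] [DiscreteMeasurableSpace Y]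
    {γ : ℝ} (hγ₀ : 0 < γ) (hγ₁ : γ < 1) (π : X × Y → X × Y → ℝ) (s₀ s z : X × Y) :
    occupancy γ π s₀ s z = pairOcc γ (chainLaw π s₀) s z := by
  unfold occupancy pairOcc
  have hm : ∀ t, MeasurableSet {ω : ℕ → X × Y | ω t = s ∧ ω (t + 1) = z} := fun t =>
    (measurableSet_state t s).inter (measurableSet_state (t + 1) z)
  have h := integral_tsum_discounted (chainLaw π s₀) hγ₀ hγ₁
    (fun t => Set.indicator {ω : ℕ → X × Y | ω t = s ∧ ω (t + 1) = z} (fun _ => (1 : ℝ))) 1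
    (fun t => measurable_const.indicator (hm t))
    (fun t ω => by by_cases h : ω ∈ {ω : ℕ → X × Y | ω t = s ∧ ω (t + 1) = z} <;> simp [h])
  simp_rw [integral_indicator_const (1 : ℝ) (hm _), smul_eq_mul, mul_one] at h
  rw [← h]
  congr! 5 with ω t
  by_cases h : ω ∈ {ω : ℕ → X × Y | ω t = s ∧ ω (t + 1) = z} <;> simp [h]

/-! ### Bellman equations for a fixed transition matrix. -/

section Bellman

variable {S : Type*} [Fintype S] {γ : ℝ} {P : S → S → ℝ}

/-- Maximum principle: at a maximiser `m` the average is at most `W m`, and `γ < 1` then leaves `W m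
≤ b`. -/
theorem le_of_le_discounted_average [Nonempty S] (hγ₀ : 0 < γ) (hγ₁ : γ < 1)
    (hP : ∀ s, P s ∈ stdSimplex ℝ S) {W : S → ℝ} {b : ℝ}
    (hW : ∀ s, W s ≤ (1 - γ) * b + γ * ∑ z, P s z * W z) (s : S) : W s ≤ b := by
  obtain ⟨m, hm⟩ := Finite.exists_max W
  have h1 : ∑ z, P m z * W z ≤ W m := by
    calc ∑ z, P m z * W z ≤ ∑ z, P m z * W m :=
          Finset.sum_le_sum fun z _ => mul_le_mul_of_nonneg_left (hm z) ((hP m).1 z)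
      _ = W m := by rw [← Finset.sum_mul, (hP m).2, one_mul]
  have h2 := hW m
  have h3 := hm s
  nlinarith

/-- These bounds fix the range of the losses, hence the constant in Hoeffding's lemma. -/
theorem bellman_bounds (hγ₀ : 0 < γ) (hγ₁ : γ < 1) (hP : ∀ s, P s ∈ stdSimplex ℝ S)
    {c W : S → ℝ} (hc : ∀ s, 0 ≤ c s) (hW : ∀ s, W s = c s + γ * ∑ z, P s z * W z) (s : S) :
    0 ≤ W s ∧ W s ≤ ‖c‖ / (1 - γ) := by
  have : Nonempty S := ⟨s⟩
  constructor
  · have := le_of_le_discounted_average hγ₀ hγ₁ hP (W := fun z => -W z) (b := 0) (fun s => by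
      simp only [mul_neg, Finset.sum_neg_distrib]
      have := hW s
      have := hc s
      linarith) s
    linarith
  · refine le_of_le_discounted_average hγ₀ hγ₁ hP (fun s => ?_) s
    rw [mul_div_cancel₀ _ (by linarith : (1 - γ) ≠ 0), hW s]
    have := (le_abs_self _).trans (norm_le_pi_norm c s)
    linarith

/-- The maximum principle for `W` and `-W` makes the map `id - γP` injective, hence surjective in
finite dimension. -/
theorem exists_bellman (hγ₀ : 0 < γ) (hγ₁ : γ < 1) (hP : ∀ s, P s ∈ stdSimplex ℝ S)
    (c : S → ℝ) : ∃ W : S → ℝ, ∀ s, W s = c s + γ * ∑ z, P s z * W z := by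
  classical
  let T : (S → ℝ) →ₗ[ℝ] (S → ℝ) :=
    LinearMap.id - γ • Matrix.toLin' (Matrix.of P)
  have hT : ∀ W s, T W s = W s - γ * ∑ z, P s z * W z := fun W s => by
    simp [T, Matrix.mulVec, dotProduct]
  have hinj : Function.Injective T := by
    rw [← LinearMap.ker_eq_bot, LinearMap.ker_eq_bot']
    intro W hW
    ext s
    have : Nonempty S := ⟨s⟩
    have h : ∀ s, W s = γ * ∑ z, P s z * W z := fun s => by
      have := hT W s
      rw [hW] at this
      simp only [Pi.zero_apply] at this
      linarith
    have h1 := le_of_le_discounted_average hγ₀ hγ₁ hP (W := W) (b := 0)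
      (fun s => by rw [h s]; simp) s
    have h2 := le_of_le_discounted_average hγ₀ hγ₁ hP (W := fun z => -W z) (b := 0)
      (fun s => by simp only [mul_neg, Finset.sum_neg_distrib]; rw [h s]; simp) s
    simp only [Pi.zero_apply]
    linarith
  obtain ⟨W, hW⟩ := LinearMap.injective_iff_surjective.1 hinj c
  refine ⟨W, fun s => ?_⟩
  have := hT W s
  rw [hW] at this
  linarith

/-- The Bellman equation paired with weights that satisfy the flow constraints. -/
theorem dot_of_flow {S : Type*} [Fintype S] {γ a : ℝ} {d c W : S → ℝ} {P μ : S → S → ℝ}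
    (hW : ∀ s, W s = c s + γ * ∑ z, P s z * W z)
    (hflow : ∑ z, d z * W z = a + γ * ∑ s, ∑ z, μ s z * W z) (hμ : ∀ s z, μ s z = d s * P s z) :
    a = ∑ s, d s * c s := by
  -- This gives a second expression for the sum of `d z * W z`; compared with `hflow`, the terms
  -- carrying `γ` cancel.
  have h : ∀ z, d z * W z = d z * c z + γ * ∑ s, μ z s * W s := fun z => by
    rw [hW z]
    simp_rw [hμ, mul_assoc]
    rw [← Finset.mul_sum]
    ring
  simp_rw [h] at hflow
  rw [Finset.sum_add_distrib, ← Finset.mul_sum] at hflow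
  linarith

end Bellman

/-! ### Performance difference. -/

section Chain

variable {S : Type*} [Fintype S] [MeasurableSpace S] [DiscreteMeasurableSpace S]
  {γ : ℝ} (hγ₀ : 0 < γ) (hγ₁ : γ < 1)
include hγ₀ hγ₁

/-- The performance difference identity. -/
theorem performance_difference {P : S → S → ℝ} (hP : ∀ s, P s ∈ stdSimplex ℝ S) {c W : S → ℝ}
    (hW : ∀ s, W s = c s + γ * ∑ z, P s z * W z) (M : Measure (ℕ → S)) [IsProbabilityMeasure M]
    {s₀ : S} (hM : M {ω | ω 0 = s₀} = 1) (G : S → S → ℝ) (hG : ∀ s, G s ∈ stdSimplex ℝ S)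
    (hMG : ∀ s z, pairOcc γ M s z = stateOcc γ M s * G s z) :
    (1 - γ) * W s₀ - ∑ s, stateOcc γ M s * c s =
      ∑ s, stateOcc γ M s * ∑ z, (P s z - G s z) * (c s + γ * W z) := by
  have h := flow_dot hγ₀ hγ₁ M hM W
  have h1 : ∀ s, stateOcc γ M s * ∑ z, (P s z - G s z) * (c s + γ * W z) =
      stateOcc γ M s * W s - stateOcc γ M s * c s - γ * ∑ z, pairOcc γ M s z * W z := fun s => by
    -- Both rows have mass one, so `c s` drops out; it is kept in the statement because `c s + γ * W
    -- z` is the Q-function.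
    have e : ∑ z, (P s z - G s z) * (c s + γ * W z) =
        γ * ∑ z, P s z * W z - γ * ∑ z, G s z * W z := by
      have e1 : ∀ z, (P s z - G s z) * (c s + γ * W z) =
          P s z * c s - G s z * c s + (γ * (P s z * W z) - γ * (G s z * W z)) := fun z => by ring
      simp_rw [e1]
      rw [Finset.sum_add_distrib, Finset.sum_sub_distrib, Finset.sum_sub_distrib,
        ← Finset.sum_mul, ← Finset.sum_mul, (hP s).2, (hG s).2, Finset.mul_sum, Finset.mul_sum]
      ring
    rw [e]
    simp_rw [hMG, mul_assoc]
    rw [← Finset.mul_sum]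
    have := hW s
    linear_combination (-stateOcc γ M s) * this
  simp_rw [h1]
  rw [Finset.sum_sub_distrib, Finset.sum_sub_distrib, ← Finset.mul_sum, h]
  ring

end Chain

/-! ### Bicausal couplings and the transition couplings they induce. -/

section Coupling

variable {X Y : Type*} [Fintype X] [Fintype Y]
  [MeasurableSpace X] [MeasurableSpace Y] [DiscreteMeasurableSpace X] [DiscreteMeasurableSpace Y]
  {PX : X → X → ℝ} (hPX : ∀ x, PX x ∈ stdSimplex ℝ X)
  {PY : Y → Y → ℝ} (hPY : ∀ y, PY y ∈ stdSimplex ℝ Y)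

omit [Fintype X] [Fintype Y] in
theorem measurable_paths_fst :
    Measurable (fun (ω : ℕ → X × Y) n => (ω n).1) :=
  measurable_pi_lambda _ fun n => measurable_fst.comp (measurable_pi_apply n)

omit [Fintype X] [Fintype Y] in
theorem measurable_paths_snd :
    Measurable (fun (ω : ℕ → X × Y) n => (ω n).2) :=
  measurable_pi_lambda _ fun n => measurable_snd.comp (measurable_pi_apply n)

theorem product_mem_couplings {p : X → ℝ} {q : Y → ℝ} (hp : p ∈ stdSimplex ℝ X)
    (hq : q ∈ stdSimplex ℝ Y) : (fun z : X × Y => p z.1 * q z.2) ∈ couplings p q := by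
  refine ⟨⟨fun z => mul_nonneg (hp.1 _) (hq.1 _), ?_⟩, fun x => ?_, fun y => ?_⟩
  · rw [Fintype.sum_prod_type, ← Finset.sum_mul_sum, hp.2, hq.2, one_mul]
  · simp only [← Finset.mul_sum, hq.2, mul_one]
  · simp only [← Finset.sum_mul, hp.2, one_mul]

include hPX hPY

/-- The independent product works. Existence matters because `otDist` is an infimum in `ℝ`, and
bounding it from below requires a nonempty set. -/
theorem exists_isBicausalCoupling (x₀ : X) (y₀ : Y) :
    ∃ M, IsBicausalCoupling PX PY x₀ y₀ M := by
  let Φ : (ℕ → X) × (ℕ → Y) → ℕ → X × Y := fun ξ n => (ξ.1 n, ξ.2 n)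
  have hΦ : Measurable Φ := measurable_pi_lambda _ fun n =>
    ((measurable_pi_apply n).comp measurable_fst).prodMk
      ((measurable_pi_apply n).comp measurable_snd)
  let N := (chainLaw PX x₀).prod (chainLaw PY y₀)
  have hcyl : ∀ (ω : ℕ → X × Y) n, Φ ⁻¹' cyl ω n =
      cyl (fun i => (ω i).1) n ×ˢ cyl (fun i => (ω i).2) n := fun ω n => by
    ext ξ
    simp only [Φ, cyl, Set.mem_preimage, Set.mem_ofPred_eq, Set.mem_prod, Prod.ext_iff,
      ← forall_and]
  have hMcyl : ∀ (ω : ℕ → X × Y) n, (N.map Φ) (cyl ω n) =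
      chainLaw PX x₀ (cyl (fun i => (ω i).1) n) * chainLaw PY y₀ (cyl (fun i => (ω i).2) n) :=
    fun ω n => by
      rw [Measure.map_apply hΦ (measurableSet_cyl ω n), hcyl, Measure.prod_prod]
  refine ⟨N.map Φ, Measure.isProbabilityMeasure_map hΦ.aemeasurable, ?_, ?_, ?_, ?_⟩
  · rw [Measure.map_map measurable_paths_fst hΦ]
    exact (Measure.map_fst_prod (μ := chainLaw PX x₀) (ν := chainLaw PY y₀)).trans (by simp)
  · rw [Measure.map_map measurable_paths_snd hΦ]
    exact (Measure.map_snd_prod (μ := chainLaw PX x₀) (ν := chainLaw PY y₀)).trans (by simp)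
  · intro ω n hne x'
    have hm : MeasurableSet {ω' : ℕ → X × Y | (ω' (n + 1)).1 = x'} :=
      measurableSet_eq_fun (measurable_fst.comp (measurable_pi_apply (n + 1))) measurable_const
    have e : Φ ⁻¹' (cyl ω n ∩ {ω' | (ω' (n + 1)).1 = x'}) =
        (cyl (fun i => (ω i).1) n ∩ {ξ | ξ (n + 1) = x'}) ×ˢ cyl (fun i => (ω i).2) n := by
      rw [Set.preimage_inter, hcyl]
      ext ξ
      simp only [Φ, Set.mem_inter_iff, Set.mem_preimage, Set.mem_ofPred_eq, Set.mem_prod]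
      tauto
    rw [hMcyl] at hne
    rw [cond_apply (measurableSet_cyl ω n), cond_apply (measurableSet_cyl _ n), hMcyl,
      Measure.map_apply hΦ ((measurableSet_cyl ω n).inter hm), e, Measure.prod_prod,
      ENNReal.mul_inv (Or.inl (left_ne_zero_of_mul hne)) (Or.inl (measure_ne_top _ _))]
    rw [mul_mul_mul_comm, ENNReal.inv_mul_cancel (right_ne_zero_of_mul hne) (measure_ne_top _ _),
      mul_one]
  · intro ω n hne y'
    have hm : MeasurableSet {ω' : ℕ → X × Y | (ω' (n + 1)).2 = y'} :=
      measurableSet_eq_fun (measurable_snd.comp (measurable_pi_apply (n + 1))) measurable_const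
    have e : Φ ⁻¹' (cyl ω n ∩ {ω' | (ω' (n + 1)).2 = y'}) =
        cyl (fun i => (ω i).1) n ×ˢ (cyl (fun i => (ω i).2) n ∩ {ξ | ξ (n + 1) = y'}) := by
      rw [Set.preimage_inter, hcyl]
      ext ξ
      simp only [Φ, Set.mem_inter_iff, Set.mem_preimage, Set.mem_ofPred_eq, Set.mem_prod]
      tauto
    rw [hMcyl] at hne
    rw [cond_apply (measurableSet_cyl ω n), cond_apply (measurableSet_cyl _ n), hMcyl,
      Measure.map_apply hΦ ((measurableSet_cyl ω n).inter hm), e, Measure.prod_prod,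
      ENNReal.mul_inv (Or.inl (left_ne_zero_of_mul hne)) (Or.inl (measure_ne_top _ _))]
    rw [mul_mul_mul_comm, ENNReal.inv_mul_cancel (left_ne_zero_of_mul hne) (measure_ne_top _ _),
      one_mul]

theorem IsBicausalCoupling.apply_zero {x₀ : X} {y₀ : Y} {M : Measure (ℕ → X × Y)}
    (hM : IsBicausalCoupling PX PY x₀ y₀ M) : M {ω | ω 0 = (x₀, y₀)} = 1 := by
  have := hM.isProbabilityMeasure
  have h1 : M {ω | (ω 0).1 = x₀} = 1 := by
    rw [← chainLaw_zero PX x₀, ← hM.map_fst,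
      Measure.map_apply measurable_paths_fst (measurableSet_state 0 x₀)]
    rfl
  have h2 : M {ω | (ω 0).2 = y₀} = 1 := by
    rw [← chainLaw_zero PY y₀, ← hM.map_snd,
      Measure.map_apply measurable_paths_snd (measurableSet_state 0 y₀)]
    rfl
  have m1 : MeasurableSet {ω : ℕ → X × Y | (ω 0).1 = x₀} :=
    measurableSet_eq_fun (measurable_fst.comp (measurable_pi_apply 0)) measurable_const
  have m2 : MeasurableSet {ω : ℕ → X × Y | (ω 0).2 = y₀} :=
    measurableSet_eq_fun (measurable_snd.comp (measurable_pi_apply 0)) measurable_const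
  rw [← prob_compl_eq_zero_iff m1] at h1
  rw [← prob_compl_eq_zero_iff m2] at h2
  rw [← prob_compl_eq_zero_iff (measurableSet_state 0 _)]
  refine measure_mono_null (fun ω hω => ?_) (measure_union_null h1 h2)
  by_contra hcon
  simp only [Set.mem_union, Set.mem_compl_iff, Set.mem_ofPred_eq, not_or, not_not] at hcon
  exact hω (Prod.ext hcon.1 hcon.2)

/-- A joint cylinder of positive mass projects to a marginal cylinder of positive mass, so both
conditional probabilities are genuine quotients. -/
theorem IsBicausalCoupling.cyl_inter_fst {x₀ : X} {y₀ : Y} {M : Measure (ℕ → X × Y)}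
    (hM : IsBicausalCoupling PX PY x₀ y₀ M) (x' : X) (ω : ℕ → X × Y) (n : ℕ) :
    M (cyl ω n ∩ {ω' | (ω' (n + 1)).1 = x'}) =
      M (cyl ω n) * ENNReal.ofReal (PX (ω n).1 x') := by
  have := hM.isProbabilityMeasure
  by_cases h0 : M (cyl ω n) = 0
  · rw [h0, zero_mul]
    exact measure_mono_null Set.inter_subset_left h0
  have hc : chainLaw PX x₀ (cyl (fun i => (ω i).1) n) ≠ 0 := fun h => h0 <| by
    rw [← hM.map_fst, Measure.map_apply measurable_paths_fst (measurableSet_cyl _ n)] at h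
    have hsub : cyl ω n ⊆ (fun (ω : ℕ → X × Y) n => (ω n).1) ⁻¹' cyl (fun i => (ω i).1) n :=
      fun ω' hω' i hi => congrArg Prod.fst (hω' i hi)
    exact measure_mono_null hsub h
  have h := hM.causal_fst ω n h0 x'
  rw [cond_apply (measurableSet_cyl ω n), cond_apply (measurableSet_cyl _ n),
    chainLaw_cyl_inter hPX, ← mul_assoc, ENNReal.inv_mul_cancel hc (measure_ne_top _ _),
    one_mul] at h
  rw [← h, ← mul_assoc, ENNReal.mul_inv_cancel h0 (measure_ne_top _ _), one_mul]

theorem IsBicausalCoupling.cyl_inter_snd {x₀ : X} {y₀ : Y} {M : Measure (ℕ → X × Y)}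
    (hM : IsBicausalCoupling PX PY x₀ y₀ M) (y' : Y) (ω : ℕ → X × Y) (n : ℕ) :
    M (cyl ω n ∩ {ω' | (ω' (n + 1)).2 = y'}) =
      M (cyl ω n) * ENNReal.ofReal (PY (ω n).2 y') := by
  have := hM.isProbabilityMeasure
  by_cases h0 : M (cyl ω n) = 0
  · rw [h0, zero_mul]
    exact measure_mono_null Set.inter_subset_left h0
  have hc : chainLaw PY y₀ (cyl (fun i => (ω i).2) n) ≠ 0 := fun h => h0 <| by
    rw [← hM.map_snd, Measure.map_apply measurable_paths_snd (measurableSet_cyl _ n)] at h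
    have hsub : cyl ω n ⊆ (fun (ω : ℕ → X × Y) n => (ω n).2) ⁻¹' cyl (fun i => (ω i).2) n :=
      fun ω' hω' i hi => congrArg Prod.snd (hω' i hi)
    exact measure_mono_null hsub h
  have h := hM.causal_snd ω n h0 y'
  rw [cond_apply (measurableSet_cyl ω n), cond_apply (measurableSet_cyl _ n),
    chainLaw_cyl_inter hPY, ← mul_assoc, ENNReal.inv_mul_cancel hc (measure_ne_top _ _),
    one_mul] at h
  rw [← h, ← mul_assoc, ENNReal.mul_inv_cancel h0 (measure_ne_top _ _), one_mul]

/-- The transition coupling extracted from nonnegative pair weights whose conditional marginals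
are `PX` and `PY` is valid, and it disintegrates these weights. -/
theorem isValid_extract {μ : X × Y → X × Y → ℝ} (hμ : ∀ s z, 0 ≤ μ s z)
    (hX : ∀ s x', ∑ y', μ s (x', y') = (∑ w, μ s w) * PX s.1 x')
    (hY : ∀ s y', ∑ x', μ s (x', y') = (∑ w, μ s w) * PY s.2 y') :
    IsValid PX PY (extract PX PY μ) ∧ ∀ s z, μ s z = (∑ w, μ s w) * extract PX PY μ s z := by
  constructor
  · intro s
    by_cases h : ∑ w, μ s w = 0
    · have : extract PX PY μ s = fun z => PX s.1 z.1 * PY s.2 z.2 := by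
        ext z; simp [extract, h]
      rw [this]
      exact product_mem_couplings (hPX _) (hPY _)
    · have : extract PX PY μ s = fun z => μ s z / ∑ w, μ s w := by
        ext z; simp [extract, h]
      rw [this]
      refine ⟨⟨fun z => div_nonneg (hμ s z) (Finset.sum_nonneg fun w _ => hμ s w), ?_⟩,
        fun x => ?_, fun y => ?_⟩
      · rw [← Finset.sum_div, div_self h]
      · simp only [← Finset.sum_div, hX, mul_div_cancel_left₀ _ h]
      · simp only [← Finset.sum_div, hY, mul_div_cancel_left₀ _ h]
  · intro s z
    by_cases h : ∑ w, μ s w = 0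
    · rw [h, zero_mul]
      exact (Finset.sum_eq_zero_iff_of_nonneg fun w _ => hμ s w).1 h z (Finset.mem_univ z)
    · simp only [extract, ne_eq, h, not_false_eq_true, if_true]
      field_simp

/-- A bicausal coupling has the pair occupancy measure of a valid transition coupling. -/
theorem IsBicausalCoupling.exists_isValid {γ : ℝ} (hγ₀ : 0 < γ) (hγ₁ : γ < 1) {x₀ : X} {y₀ : Y}
    {M : Measure (ℕ → X × Y)} (hM : IsBicausalCoupling PX PY x₀ y₀ M) :
    ∃ G, IsValid PX PY G ∧ ∀ s z, pairOcc γ M s z = stateOcc γ M s * G s z := by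
  classical
  have := hM.isProbabilityMeasure
  -- `M` need not be Markov, but the conditional marginals depend on the history only through its
  -- last state; summing over histories ending in `s` keeps them.
  have hX : ∀ s x', ∑ y', pairOcc γ M s (x', y') = (∑ w, pairOcc γ M s w) * PX s.1 x' :=
    fun s x' => by
      rw [sum_pairOcc hγ₀ hγ₁, ← sum_fiber_pairOcc hγ₀ hγ₁ M Prod.fst (fun s => PX s.1)
        (fun s => (hPX s.1).1) (fun i ω n => hM.cyl_inter_fst hPX hPY i ω n)]
      simp [Finset.sum_filter, Fintype.sum_prod_type_right]
  have hY : ∀ s y', ∑ x', pairOcc γ M s (x', y') = (∑ w, pairOcc γ M s w) * PY s.2 y' :=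
    fun s y' => by
      rw [sum_pairOcc hγ₀ hγ₁, ← sum_fiber_pairOcc hγ₀ hγ₁ M Prod.snd (fun s => PY s.2)
        (fun s => (hPY s.2).1) (fun i ω n => hM.cyl_inter_snd hPX hPY i ω n)]
      simp [Finset.sum_filter, Fintype.sum_prod_type]
  obtain ⟨h1, h2⟩ := isValid_extract hPX hPY (pairOcc_nonneg hγ₀ hγ₁ M) hX hY
  refine ⟨_, h1, fun s z => ?_⟩
  rw [← sum_pairOcc hγ₀ hγ₁]
  exact h2 s z

end Coupling

/-! ### Relative entropy, Gibbs and Hoeffding inequalities. -/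

section Entropy

variable {Z I : Type*} [Fintype Z] [Fintype I]

/-- Relative entropy of two nonnegative functions on a finite set. -/
def relEnt (G F : Z → ℝ) : ℝ := ∑ z, G z * Real.log (G z / F z)

/-- The Gibbs variational inequality. -/
theorem sum_mul_sub_relEnt_le_log {p w : I → ℝ} (hp : p ∈ stdSimplex ℝ I) (hw : ∀ i, 0 ≤ w i)
    (hpw : ∀ i, p i ≠ 0 → w i ≠ 0) (f : I → ℝ) :
    ∑ i, p i * f i - relEnt p w ≤ Real.log (∑ i, w i * Real.exp (f i)) := by
  set T := ∑ i, w i * Real.exp (f i) with hT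
  have hT0 : 0 < T := by
    obtain ⟨i, hi⟩ : ∃ i, p i ≠ 0 := by
      by_contra! h
      have := hp.2
      simp [h] at this
    refine Finset.sum_pos' (fun i _ => mul_nonneg (hw i) (Real.exp_pos _).le)
      ⟨i, Finset.mem_univ i, mul_pos ((hw i).lt_of_ne' (hpw i hi)) (Real.exp_pos _)⟩
  -- This is `log t ≤ t - 1` at the ratio of the Gibbs weight to `p i`, multiplied by `p i`; the
  -- right-hand sides sum to zero.
  have key : ∀ i, p i * f i - p i * Real.log (p i / w i) - p i * Real.log T ≤
      w i * Real.exp (f i) / T - p i := fun i => by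
    by_cases h : p i = 0
    · simp only [h, zero_mul, sub_zero]
      exact div_nonneg (mul_nonneg (hw i) (Real.exp_pos _).le) hT0.le
    · have h1 : 0 < p i := (hp.1 i).lt_of_ne' h
      have h2 : 0 < w i := (hw i).lt_of_ne' (hpw i h)
      have h3 : f i - Real.log (p i / w i) - Real.log T =
          Real.log (w i * Real.exp (f i) / T / p i) := by
        rw [Real.log_div h1.ne' h2.ne', Real.log_div (by positivity) h1.ne',
          Real.log_div (by positivity) hT0.ne', Real.log_mul h2.ne' (Real.exp_pos _).ne',
          Real.log_exp]
        ring
      have h4 := Real.log_le_sub_one_of_pos (show 0 < w i * Real.exp (f i) / T / p i by positivity)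
      calc p i * f i - p i * Real.log (p i / w i) - p i * Real.log T
          = p i * Real.log (w i * Real.exp (f i) / T / p i) := by rw [← h3]; ring
        _ ≤ p i * (w i * Real.exp (f i) / T / p i - 1) := mul_le_mul_of_nonneg_left h4 h1.le
        _ = _ := by field_simp
  have h := Finset.sum_le_sum fun i (_ : i ∈ Finset.univ) => key i
  rw [Finset.sum_sub_distrib, Finset.sum_sub_distrib, ← Finset.sum_mul, hp.2, one_mul,
    Finset.sum_sub_distrib, hp.2, ← Finset.sum_div, ← hT, div_self hT0.ne'] at h
  unfold relEnt
  linarith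

/-- This is the Gibbs inequality with test function zero. Since `x / 0 = 0` and `log 0 = 0`, a point
of `G` outside the support of `F` would contribute zero instead of infinity, hence the support
condition. -/
theorem relEnt_nonneg {G F : Z → ℝ} (hG : G ∈ stdSimplex ℝ Z) (hF : F ∈ stdSimplex ℝ Z)
    (hGF : ∀ z, G z ≠ 0 → F z ≠ 0) : 0 ≤ relEnt G F := by
  have := sum_mul_sub_relEnt_le_log hG hF.1 hGF 0
  simp [hF.2] at this
  exact this

theorem relEnt_const_le {G : Z → ℝ} (hG : G ∈ stdSimplex ℝ Z) {n : ℝ} (hn : 1 ≤ n) :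
    relEnt G (fun _ => 1 / n) ≤ Real.log n := by
  have : ∀ z, G z * Real.log (G z / (1 / n)) ≤ G z * Real.log n := fun z => by
    by_cases h : G z = 0
    · simp [h]
    have h0 := (hG.1 z).lt_of_ne' h
    refine mul_le_mul_of_nonneg_left (Real.log_le_log (by positivity) ?_) h0.le
    rw [div_div_eq_mul_div, div_one]
    have : G z ≤ 1 := hG.2 ▸ Finset.single_le_sum (fun z _ => hG.1 z) (Finset.mem_univ z)
    nlinarith
  calc relEnt G (fun _ => 1 / n) ≤ ∑ z, G z * Real.log n := Finset.sum_le_sum fun z _ => this z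
    _ = _ := by rw [← Finset.sum_mul, hG.2, one_mul]

/-- Hoeffding's lemma on a finite set. -/
theorem log_sum_exp_le {F : Z → ℝ} (hF : F ∈ stdSimplex ℝ Z) {g : Z → ℝ} {b : ℝ}
    (hg : ∀ z, 0 ≤ g z ∧ g z ≤ b) :
    Real.log (∑ z, F z * Real.exp (-g z)) ≤ -∑ z, F z * g z + b ^ 2 / 8 := by
  let m : MeasurableSpace Z := ⊤
  have hd : DiscreteMeasurableSpace Z := ⟨fun _ => trivial⟩
  let μ : Measure Z := ∑ z, ENNReal.ofReal (F z) • Measure.dirac z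
  have hμ : IsProbabilityMeasure μ := by
    constructor
    simp only [μ, Measure.coe_finsetSum, Measure.coe_smul, Finset.sum_apply, Pi.smul_apply,
      measure_univ, smul_eq_mul, mul_one]
    rw [← ENNReal.ofReal_sum_of_nonneg (fun z _ => hF.1 z), hF.2, ENNReal.ofReal_one]
  have hint : ∀ f : Z → ℝ, ∫ z, f z ∂μ = ∑ z, F z * f z := fun f => by
    rw [integral_finsetSum_measure fun z _ =>
      Integrable.smul_measure Integrable.of_finite ENNReal.ofReal_ne_top]
    refine Finset.sum_congr rfl fun z _ => ?_
    rw [integral_smul_measure, integral_dirac, ENNReal.toReal_ofReal (hF.1 z), smul_eq_mul]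
  have hs := hasSubgaussianMGF_of_mem_Icc (μ := μ) (X := fun z => -g z) (a := -b) (b := 0)
    (Measurable.of_discrete).aemeasurable
    (ae_of_all _ fun z => ⟨neg_le_neg (hg z).2, neg_nonpos.2 (hg z).1⟩)
  have h := hs.mgf_le 1
  simp only [mgf, hint, one_mul, mul_neg, Finset.sum_neg_distrib, sub_neg_eq_add, one_pow,
    mul_one, Real.exp_add] at h
  have e : ((((‖b‖₊ / 2) ^ 2 : NNReal)) : ℝ) / 2 = b ^ 2 / 8 := by
    push_cast
    rw [Real.norm_eq_abs, div_pow, sq_abs]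
    ring
  simp only [zero_add] at h
  simp_rw [← mul_assoc] at h
  rw [← Finset.sum_mul, e] at h
  have hpos : 0 < ∑ z, F z * Real.exp (-g z) := by
    obtain ⟨z, hz⟩ : ∃ i, F i ≠ 0 := by
      by_contra! h
      have := hF.2
      simp [h] at this
    exact Finset.sum_pos' (fun i _ => mul_nonneg (hF.1 i) (Real.exp_pos _).le)
      ⟨z, Finset.mem_univ z, mul_pos ((hF.1 z).lt_of_ne' hz) (Real.exp_pos _)⟩
  have h2 := Real.log_le_log (by positivity) h
  rw [Real.log_mul hpos.ne' (Real.exp_pos _).ne', Real.log_exp, Real.log_exp] at h2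
  linarith

end Entropy

/-! ### One round of mirror descent with a single marginal constraint. -/

section Mirror

variable {Z I : Type*} [Fintype Z] [Fintype I] [DecidableEq I]

/-- The image of a function under `φ`, obtained by summation over the fibres. -/
def fiberSum (φ : Z → I) (F : Z → ℝ) (i : I) : ℝ := ∑ z with φ z = i, F z

/-- The multiplicative update of `F` with weights `exp (-g)` that restores the image `p` under
`φ`. -/
def mirrorUpdate (φ : Z → I) (p : I → ℝ) (g F : Z → ℝ) (z : Z) : ℝ :=
  F z * Real.exp (-g z) / fiberSum φ (fun w => F w * Real.exp (-g w)) (φ z) * p (φ z)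

theorem sum_fiberSum_mul (φ : Z → I) (F : Z → ℝ) (f : I → ℝ) :
    ∑ i, fiberSum φ F i * f i = ∑ z, F z * f (φ z) := by
  unfold fiberSum
  rw [← Finset.sum_fiberwise Finset.univ φ fun z => F z * f (φ z)]
  refine Finset.sum_congr rfl fun i _ => ?_
  rw [Finset.sum_mul]
  refine Finset.sum_congr rfl fun z hz => ?_
  rw [(Finset.mem_filter.1 hz).2]

theorem fiberSum_nonneg {φ : Z → I} {F : Z → ℝ} (hF : ∀ z, 0 ≤ F z) (i : I) :
    0 ≤ fiberSum φ F i := Finset.sum_nonneg fun z _ => hF z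

theorem fiberSum_ne_zero {φ : Z → I} {F : Z → ℝ} (hF : ∀ z, 0 ≤ F z) {z : Z} (hz : F z ≠ 0) :
    fiberSum φ F (φ z) ≠ 0 :=
  (Finset.sum_pos' (fun z _ => hF z)
    ⟨z, by simp, (hF z).lt_of_ne' hz⟩).ne'

variable {φ : Z → I} {p : I → ℝ} {g F G R : Z → ℝ} (hp : p ∈ stdSimplex ℝ I)
  (hF : F ∈ stdSimplex ℝ Z) (hG : G ∈ stdSimplex ℝ Z) (hGp : fiberSum φ G = p)
  (hGF : ∀ z, G z ≠ 0 → F z ≠ 0)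

include hF hG hGp hGF

/-- `G` charges every fibre with `p i ≠ 0` and is supported within `F`, so the denominators of the
update can vanish only where `p` does. -/
theorem fiberSum_tilt_ne_zero (g : Z → ℝ) {i : I} (hi : p i ≠ 0) :
    fiberSum φ (fun w => F w * Real.exp (-g w)) i ≠ 0 := by
  rw [← hGp] at hi
  obtain ⟨z, hz, hGz⟩ := Finset.exists_ne_zero_of_sum_ne_zero hi
  rw [← (Finset.mem_filter.1 hz).2]
  exact fiberSum_ne_zero (F := fun w => F w * Real.exp (-g w))
    (fun w => mul_nonneg (hF.1 w) (Real.exp_pos _).le)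
    (mul_ne_zero (hGF z hGz) (Real.exp_pos _).ne')

theorem mirrorUpdate_ne_zero (g : Z → ℝ) {z : Z} (hz : G z ≠ 0) :
    mirrorUpdate φ p g F z ≠ 0 := by
  have hpz : p (φ z) ≠ 0 := hGp ▸ fiberSum_ne_zero hG.1 hz
  exact mul_ne_zero (div_ne_zero (mul_ne_zero (hGF z hz) (Real.exp_pos _).ne')
    (fiberSum_tilt_ne_zero hF hG hGp hGF g hpz)) hpz

theorem fiberSum_mirrorUpdate (g : Z → ℝ) : fiberSum φ (mirrorUpdate φ p g F) = p := by
  ext i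
  have : fiberSum φ (mirrorUpdate φ p g F) i =
      fiberSum φ (fun w => F w * Real.exp (-g w)) i /
        fiberSum φ (fun w => F w * Real.exp (-g w)) i * p i := by
    conv_rhs => rw [fiberSum, Finset.sum_div, Finset.sum_mul]
    refine Finset.sum_congr rfl fun z hz => ?_
    rw [mirrorUpdate, (Finset.mem_filter.1 hz).2]
    rfl
  rw [this]
  by_cases hi : p i = 0
  · simp [hi]
  · rw [div_self (fiberSum_tilt_ne_zero hF hG hGp hGF g hi), one_mul]

include hp

theorem mirrorUpdate_mem_stdSimplex (g : Z → ℝ) : mirrorUpdate φ p g F ∈ stdSimplex ℝ Z := by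
  refine ⟨fun z => mul_nonneg (div_nonneg (mul_nonneg (hF.1 z) (Real.exp_pos _).le)
    (fiberSum_nonneg (fun w => mul_nonneg (hF.1 w) (Real.exp_pos _).le) _)) (hp.1 _), ?_⟩
  have := sum_fiberSum_mul φ (mirrorUpdate φ p g F) 1
  simp only [fiberSum_mirrorUpdate hF hG hGp hGF g, Pi.one_apply, mul_one, hp.2] at this
  exact this.symm

/-- The progress of a multiplicative update, measured by relative entropy. -/
theorem relEnt_sub_relEnt_mirrorUpdate (g : Z → ℝ) :
    relEnt G F - relEnt G (mirrorUpdate φ p g F) =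
      relEnt p (fiberSum φ (fun w => F w * Real.exp (-g w))) - ∑ z, G z * g z := by
  set T := fiberSum φ (fun w => F w * Real.exp (-g w)) with hT
  -- Since `G` has image `p`, the entropy on the index set pulls back to a sum against `G`, and the
  -- identity can be checked termwise.
  have h1 : relEnt p T = ∑ z, G z * Real.log (p (φ z) / T (φ z)) := by
    rw [← sum_fiberSum_mul φ G fun i => Real.log (p i / T i), hGp]; rfl
  rw [h1]
  unfold relEnt
  rw [← Finset.sum_sub_distrib, ← Finset.sum_sub_distrib]
  refine Finset.sum_congr rfl fun z _ => ?_
  by_cases hz : G z = 0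
  · simp [hz]
  have hFz := hGF z hz
  have hpz : p (φ z) ≠ 0 := hGp ▸ fiberSum_ne_zero hG.1 hz
  have hTz : T (φ z) ≠ 0 := fiberSum_tilt_ne_zero hF hG hGp hGF g hpz
  have he := (Real.exp_pos (-g z)).ne'
  rw [mirrorUpdate, ← hT, Real.log_div hz hFz, Real.log_div hz (by positivity),
    Real.log_mul (by positivity) hpz, Real.log_div (by positivity) hTz, Real.log_mul hFz he,
    Real.log_exp, Real.log_div hpz hTz]
  ring

/-- The Gibbs inequality on `I` with test function `-f`, then Hoeffding's lemma on `Z` for `g + f ∘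
φ`. The free potential `f` will pay for the rounding. -/
theorem sum_fiber_exp_le (g : Z → ℝ) {b : ℝ} (f : I → ℝ)
    (hgf : ∀ z, 0 ≤ g z + f (φ z) ∧ g z + f (φ z) ≤ b) :
    ∑ z, F z * g z + ∑ z, F z * f (φ z) - ∑ i, p i * f i ≤
      relEnt p (fiberSum φ (fun w => F w * Real.exp (-g w))) + b ^ 2 / 8 := by
  have h1 := sum_mul_sub_relEnt_le_log hp
    (fiberSum_nonneg (φ := φ) (F := fun w => F w * Real.exp (-g w))
      fun w => mul_nonneg (hF.1 w) (Real.exp_pos _).le)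
    (fun i hi => fiberSum_tilt_ne_zero hF hG hGp hGF g hi) (fun i => -f i)
  have h2 := log_sum_exp_le hF hgf
  rw [sum_fiberSum_mul φ (fun w => F w * Real.exp (-g w)) fun i => Real.exp (-f i)] at h1
  simp_rw [mul_assoc, ← Real.exp_add] at h1
  simp_rw [neg_add, mul_add, Finset.sum_add_distrib] at h2
  simp only [mul_neg, Finset.sum_neg_distrib] at h1
  linarith

/-- One round of mirror descent, without any control on the comparison of `R` and `F`. -/
theorem mirror_round_coarse (hR : R ∈ stdSimplex ℝ Z) {h : ℝ} (hg : ∀ z, 0 ≤ g z ∧ g z ≤ h) :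
    ∑ z, (R z - G z) * g z ≤
      relEnt G F - relEnt G (mirrorUpdate φ p g F) + h ^ 2 / 2 + h := by
  rw [relEnt_sub_relEnt_mirrorUpdate hp hF hG hGp hGF]
  have h1 := sum_fiber_exp_le hp hF hG hGp hGF g (b := h) 0 (by simpa using hg)
  simp only [Pi.zero_apply, mul_zero, Finset.sum_const_zero, add_zero, sub_zero] at h1
  have h2 : ∑ z, R z * g z ≤ h := by
    calc ∑ z, R z * g z ≤ ∑ z, R z * h :=
          Finset.sum_le_sum fun z _ => mul_le_mul_of_nonneg_left (hg z).2 (hR.1 z)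
      _ = h := by rw [← Finset.sum_mul, hR.2, one_mul]
  have h3 : 0 ≤ ∑ z, F z * g z := Finset.sum_nonneg fun z _ => mul_nonneg (hF.1 z) (hg z).1
  simp_rw [sub_mul]
  rw [Finset.sum_sub_distrib]
  nlinarith [sq_nonneg h]

/-- One round of mirror descent, evaluated at a distribution `R` which dominates the part of `F`
that is compatible with the constraint `p`. -/
theorem mirror_round (hR : R ∈ stdSimplex ℝ Z)
    (hRF : ∀ z, min (p (φ z) / fiberSum φ F (φ z)) 1 * F z ≤ R z)
    {h : ℝ} (hg : ∀ z, 0 ≤ g z ∧ g z ≤ h) :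
    ∑ z, (R z - G z) * g z ≤
      relEnt G F - relEnt G (mirrorUpdate φ p g F) + h ^ 2 / 2 := by
  rw [relEnt_sub_relEnt_mirrorUpdate hp hF hG hGp hGF]
  have hh : 0 ≤ h := by
    obtain ⟨z, -⟩ : ∃ i, F i ≠ 0 := by
      by_contra! h
      have := hF.2
      simp [h] at this
    exact (hg z).1.trans (hg z).2
  -- With this potential, the sum of `F z * f (φ z)` minus that of `p i * f i` is `h` times the
  -- excess mass of `F`.
  let f : I → ℝ := fun i => if p i < fiberSum φ F i then h else 0
  have hf : ∀ i, 0 ≤ f i ∧ f i ≤ h := fun i => by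
    simp only [f]; split_ifs <;> simp [hh]
  -- Both `g` and `f` are at most `h`, so the Hoeffding term is `(2 * h) ^ 2 / 8 = h ^ 2 / 2`.
  have h1 := sum_fiber_exp_le hp hF hG hGp hGF g (b := 2 * h) f fun z =>
    ⟨add_nonneg (hg z).1 (hf _).1, by linarith [(hg z).2, (hf (φ z)).2]⟩
  -- `F` and `R` have equal mass, so `-g` may be shifted to `h - g ≥ 0`; then the lower bound on `R`
  -- is all that is needed.
  have h2 : ∑ z, (F z - R z) * (h - g z) ≤
      ∑ z, F z * (f (φ z) * (1 - p (φ z) / fiberSum φ F (φ z))) := by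
    refine Finset.sum_le_sum fun z _ => ?_
    by_cases hz : F z = 0
    · rw [hz]
      have := mul_nonneg (hR.1 z) (sub_nonneg.2 (hg z).2)
      nlinarith
    have hν : 0 < fiberSum φ F (φ z) :=
      (fiberSum_nonneg hF.1 _).lt_of_ne' (fiberSum_ne_zero hF.1 hz)
    have hFz := hF.1 z
    have hRz := hRF z
    simp only [f]
    split_ifs with hlt
    · have hle := (div_lt_one hν).2 hlt
      rw [min_eq_left hle.le] at hRz
      calc (F z - R z) * (h - g z) ≤ (F z - p (φ z) / fiberSum φ F (φ z) * F z) * (h - g z) :=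
            mul_le_mul_of_nonneg_right (by linarith) (sub_nonneg.2 (hg z).2)
        _ ≤ (F z - p (φ z) / fiberSum φ F (φ z) * F z) * h :=
            mul_le_mul_of_nonneg_left (by linarith [(hg z).1]) (by nlinarith)
        _ = _ := by ring
    · rw [min_eq_right ((one_le_div hν).2 (not_lt.1 hlt)), one_mul] at hRz
      rw [zero_mul, mul_zero]
      exact mul_nonpos_of_nonpos_of_nonneg (by linarith) (sub_nonneg.2 (hg z).2)
  have h3 : ∑ z, F z * (f (φ z) * (1 - p (φ z) / fiberSum φ F (φ z))) =
      ∑ z, F z * f (φ z) - ∑ i, p i * f i := by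
    rw [← sum_fiberSum_mul φ F fun i => f i * (1 - p i / fiberSum φ F i),
      ← sum_fiberSum_mul φ F f, ← Finset.sum_sub_distrib]
    refine Finset.sum_congr rfl fun i _ => ?_
    simp only [f]
    split_ifs with hlt
    · have : fiberSum φ F i ≠ 0 := ((hp.1 i).trans_lt hlt).ne'
      field_simp
    · simp
  have h4 : ∑ z, (F z - R z) * (h - g z) = ∑ z, R z * g z - ∑ z, F z * g z := by
    have e : ∀ z, (F z - R z) * (h - g z) = F z * h - R z * h + (R z * g z - F z * g z) :=
      fun z => by ring
    simp_rw [e]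
    rw [Finset.sum_add_distrib, Finset.sum_sub_distrib, Finset.sum_sub_distrib, ← Finset.sum_mul,
      ← Finset.sum_mul, hF.2, hR.2]
    ring
  simp_rw [sub_mul]
  rw [Finset.sum_sub_distrib]
  linarith

end Mirror

/-! ### The rounding procedure. -/

section Rounding

variable {X Y : Type*} [Fintype X] [Fintype Y]

theorem fiberSum_fst [DecidableEq X] (F : X × Y → ℝ) (x : X) :
    fiberSum Prod.fst F x = ∑ y, F (x, y) := by
  simp [fiberSum, Finset.sum_filter, Fintype.sum_prod_type_right]

theorem fiberSum_snd [DecidableEq Y] (F : X × Y → ℝ) (y : Y) :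
    fiberSum Prod.snd F y = ∑ x, F (x, y) := by
  simp [fiberSum, Finset.sum_filter, Fintype.sum_prod_type]

theorem min_div_one_mul_le {a b : ℝ} (ha : 0 ≤ a) (hb : 0 ≤ b) : min (a / b) 1 * b ≤ a := by
  rcases hb.eq_or_lt with rfl | hb
  · simpa
  · calc min (a / b) 1 * b ≤ a / b * b := mul_le_mul_of_nonneg_right (min_le_left _ _) hb.le
      _ = a := div_mul_cancel₀ _ hb.ne'

variable {p : X → ℝ} {q : Y → ℝ} {F : X × Y → ℝ}

theorem sum_scaleRows (x : X) :
    ∑ y, scaleRows p F (x, y) = min (p x / ∑ y, F (x, y)) 1 * ∑ y, F (x, y) := by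
  simp only [scaleRows, Finset.mul_sum]

theorem sum_scaleCols (y : Y) :
    ∑ x, scaleCols q F (x, y) = min (q y / ∑ x, F (x, y)) 1 * ∑ x, F (x, y) := by
  rw [mul_comm, Finset.sum_mul]
  rfl

theorem scaleRows_nonneg (hp : ∀ x, 0 ≤ p x) (hF : ∀ z, 0 ≤ F z) (z : X × Y) :
    0 ≤ scaleRows p F z :=
  mul_nonneg (le_min (div_nonneg (hp _) (Finset.sum_nonneg fun _ _ => hF _)) zero_le_one) (hF z)

theorem scaleCols_nonneg (hq : ∀ y, 0 ≤ q y) (hF : ∀ z, 0 ≤ F z) (z : X × Y) :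
    0 ≤ scaleCols q F z :=
  mul_nonneg (hF z) (le_min (div_nonneg (hq _) (Finset.sum_nonneg fun _ _ => hF _)) zero_le_one)

theorem scaleRows_le (hF : ∀ z, 0 ≤ F z) (z : X × Y) : scaleRows p F z ≤ F z :=
  mul_le_of_le_one_left (hF z) (min_le_right _ _)

theorem scaleCols_le (hF : ∀ z, 0 ≤ F z) (z : X × Y) : scaleCols q F z ≤ F z :=
  mul_le_of_le_one_right (hF z) (min_le_right _ _)

/-- Scaling down the columns has no effect if no column has too much mass. -/
theorem scaleCols_eq_self (hF : ∀ z, 0 ≤ F z) (h : ∀ y, ∑ x, F (x, y) ≤ q y) :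
    scaleCols q F = F := by
  ext ⟨x, y⟩
  rcases (hF (x, y)).eq_or_lt with h0 | h0
  · simp [scaleCols, ← h0]
  · have hpos : 0 < ∑ x, F (x, y) :=
      h0.trans_le (Finset.single_le_sum (f := fun x => F (x, y)) (fun _ _ => hF _)
        (Finset.mem_univ x))
    simp only [scaleCols]
    rw [min_eq_right ((one_le_div hpos).2 (h y)), mul_one]

/-- Scaling down the rows has no effect if no row has too much mass. -/
theorem scaleRows_eq_self (hF : ∀ z, 0 ≤ F z) (h : ∀ x, ∑ y, F (x, y) ≤ p x) :
    scaleRows p F = F := by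
  ext ⟨x, y⟩
  rcases (hF (x, y)).eq_or_lt with h0 | h0
  · simp [scaleRows, ← h0]
  · have hpos : 0 < ∑ y, F (x, y) :=
      h0.trans_le (Finset.single_le_sum (f := fun y => F (x, y)) (fun _ _ => hF _)
        (Finset.mem_univ y))
    simp only [scaleRows]
    rw [min_eq_right ((one_le_div hpos).2 (h x)), one_mul]

variable (hp : p ∈ stdSimplex ℝ X) (hq : q ∈ stdSimplex ℝ Y) (hF : ∀ z, 0 ≤ F z)
include hp hq hF

theorem sum_scaled_row_le (x : X) : ∑ y, scaleCols q (scaleRows p F) (x, y) ≤ p x := by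
  calc _ ≤ ∑ y, scaleRows p F (x, y) :=
        Finset.sum_le_sum fun y _ => scaleCols_le (scaleRows_nonneg hp.1 hF) _
    _ ≤ p x := by
        rw [sum_scaleRows]
        exact min_div_one_mul_le (hp.1 x) (Finset.sum_nonneg fun _ _ => hF _)

theorem sum_scaled_col_le (y : Y) : ∑ x, scaleCols q (scaleRows p F) (x, y) ≤ q y := by
  rw [sum_scaleCols]
  exact min_div_one_mul_le (hq.1 y) (Finset.sum_nonneg fun _ _ => scaleRows_nonneg hp.1 hF _)

theorem le_roundMatrix (z : X × Y) : scaleCols q (scaleRows p F) z ≤ roundMatrix p q F z := by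
  simp only [roundMatrix]
  have h1 := sub_nonneg.2 (sum_scaled_row_le hp hq hF z.1)
  have h2 := sub_nonneg.2 (sum_scaled_col_le hp hq hF z.2)
  have := div_nonneg (mul_nonneg h1 h2) (Finset.sum_nonneg fun x (_ : x ∈ Finset.univ) =>
    abs_nonneg (p x - ∑ y, scaleCols q (scaleRows p F) (x, y)))
  linarith

/-- The row and column errors are nonnegative with the same total `δ`, since `p` and `q` have equal
mass. The rank-one term therefore repairs both marginals at once, and for `δ = 0` nothing is
missing. -/
theorem roundMatrix_mem_couplings : roundMatrix p q F ∈ couplings p q := by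
  set H := scaleCols q (scaleRows p F) with hH
  have h1 : ∀ x, 0 ≤ p x - ∑ y, H (x, y) := fun x => sub_nonneg.2 (sum_scaled_row_le hp hq hF x)
  have h2 : ∀ y, 0 ≤ q y - ∑ x, H (x, y) := fun y => sub_nonneg.2 (sum_scaled_col_le hp hq hF y)
  set δ := ∑ x, |p x - ∑ y, H (x, y)| with hδ
  have e1 : ∑ x, (p x - ∑ y, H (x, y)) = δ :=
    Finset.sum_congr rfl fun x _ => (abs_of_nonneg (h1 x)).symm
  have e2 : ∑ y, (q y - ∑ x, H (x, y)) = δ := by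
    rw [← e1, Finset.sum_sub_distrib, Finset.sum_sub_distrib, hp.2, hq.2, Finset.sum_comm]
  have hR : ∀ z, roundMatrix p q F z =
      H z + (p z.1 - ∑ y, H (z.1, y)) * (q z.2 - ∑ x, H (x, z.2)) / δ := fun z => rfl
  have hrow : ∀ x, ∑ y, roundMatrix p q F (x, y) = p x := fun x => by
    simp only [hR]
    rw [Finset.sum_add_distrib, ← Finset.sum_div, ← Finset.mul_sum, e2]
    by_cases h : δ = 0
    · have := (Finset.sum_eq_zero_iff_of_nonneg fun x _ => h1 x).1 (e1.trans h) x
        (Finset.mem_univ x)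
      rw [h, mul_zero, zero_div]
      linarith
    · rw [mul_div_cancel_right₀ _ h]; ring
  have hcol : ∀ y, ∑ x, roundMatrix p q F (x, y) = q y := fun y => by
    simp only [hR]
    rw [Finset.sum_add_distrib, ← Finset.sum_div, ← Finset.sum_mul, e1]
    by_cases h : δ = 0
    · have := (Finset.sum_eq_zero_iff_of_nonneg fun y _ => h2 y).1 (e2.trans h) y
        (Finset.mem_univ y)
      rw [h, zero_mul, zero_div]
      linarith
    · rw [mul_div_cancel_left₀ _ h]; ring
  refine ⟨⟨fun z => (scaleCols_nonneg hq.1 (scaleRows_nonneg hp.1 hF) z).trans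
    (le_roundMatrix hp hq hF z), ?_⟩, hrow, hcol⟩
  rw [Fintype.sum_prod_type]
  simp_rw [hrow]
  exact hp.2

/-- Scaling rows down cannot overfill columns that already fit, so the column scaling is idle. This
supplies the domination hypothesis of `mirror_round` in odd rounds. -/
theorem le_roundMatrix_of_col [DecidableEq X] (hcol : ∀ y, ∑ x, F (x, y) = q y) (z : X × Y) :
    min (p z.1 / fiberSum Prod.fst F z.1) 1 * F z ≤ roundMatrix p q F z := by
  have h := le_roundMatrix hp hq hF z
  rw [scaleCols_eq_self (scaleRows_nonneg hp.1 hF) fun y =>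
    (Finset.sum_le_sum fun x _ => scaleRows_le hF (x, y)).trans (hcol y).le] at h
  rwa [fiberSum_fst]

theorem le_roundMatrix_of_row [DecidableEq Y] (hrow : ∀ x, ∑ y, F (x, y) = p x) (z : X × Y) :
    min (q z.2 / fiberSum Prod.snd F z.2) 1 * F z ≤ roundMatrix p q F z := by
  have h := le_roundMatrix hp hq hF z
  rw [scaleRows_eq_self hF fun x => (hrow x).le] at h
  rw [fiberSum_snd, mul_comm]
  exact h

end Rounding

/-! ### Telescoping the rounds, and the choice of constants. -/

section Regret

variable {X Y : Type*} [Fintype X] [Fintype Y] [DecidableEq X] [DecidableEq Y]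

/-- The total regret of the rounded iterates of alternating multiplicative updates, started from
the uniform distribution. -/
theorem sinkhorn_regret {p : X → ℝ} {q : Y → ℝ} (hp : p ∈ stdSimplex ℝ X)
    (hq : q ∈ stdSimplex ℝ Y) {G : X × Y → ℝ} (hG : G ∈ couplings p q) {h : ℝ} (K : ℕ)
    (hK : 1 ≤ K) (F g : ℕ → X × Y → ℝ)
    (hg : ∀ k, 1 ≤ k → k ≤ K → ∀ z, 0 ≤ g k z ∧ g k z ≤ h)
    (hF₁ : F 1 = fun _ => 1 / ((Fintype.card X : ℝ) * Fintype.card Y))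
    (hodd : ∀ k, 1 ≤ k → k < K → Odd k → F (k + 1) = mirrorUpdate Prod.fst p (g k) (F k))
    (heven : ∀ k, 1 ≤ k → k < K → Even k → F (k + 1) = mirrorUpdate Prod.snd q (g k) (F k)) :
    ∑ k ∈ Finset.Icc 1 K, ∑ z, (roundMatrix p q (F k) z - G z) * g k z ≤
      Real.log ((Fintype.card X : ℝ) * Fintype.card Y) + K * (h ^ 2 / 2) + h := by
  have hGp : fiberSum Prod.fst G = p := by ext x; rw [fiberSum_fst, hG.2.1]
  have hGq : fiberSum Prod.snd G = q := by ext y; rw [fiberSum_snd, hG.2.2]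
  have hn : 1 ≤ (Fintype.card X : ℝ) * Fintype.card Y := by
    obtain ⟨z⟩ : Nonempty (X × Y) := by
      by_contra hempty
      rw [not_nonempty_iff] at hempty
      have := hG.1.2
      simp at this
    have h1 : 0 < Fintype.card X := Fintype.card_pos_iff.2 ⟨z.1⟩
    have h2 : 0 < Fintype.card Y := Fintype.card_pos_iff.2 ⟨z.2⟩
    exact_mod_cast Nat.mul_pos h1 h2
  -- Unlike the iterates, `upd` also makes an update in round `K`, so the telescoping covers the
  -- last round.
  let upd : ℕ → X × Y → ℝ := fun k =>
    if Odd k then mirrorUpdate Prod.fst p (g k) (F k) else mirrorUpdate Prod.snd q (g k) (F k)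
  have hupd : ∀ k, 1 ≤ k → k < K → F (k + 1) = upd k := fun k h1 h2 => by
    by_cases ho : Odd k
    · simp only [upd, if_pos ho, hodd k h1 h2 ho]
    · simp only [upd, if_neg ho, heven k h1 h2 (Nat.not_odd_iff_even.1 ho)]
  have hupd_inv : ∀ k, F k ∈ stdSimplex ℝ (X × Y) → (∀ z, G z ≠ 0 → F k z ≠ 0) →
      upd k ∈ stdSimplex ℝ (X × Y) ∧ (∀ z, G z ≠ 0 → upd k z ≠ 0) ∧
      (Even (k + 1) → ∀ x, ∑ y, upd k (x, y) = p x) ∧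
      (Odd (k + 1) → ∀ y, ∑ x, upd k (x, y) = q y) := fun k h1 h2 => by
    by_cases ho : Odd k
    · simp only [upd, if_pos ho]
      refine ⟨mirrorUpdate_mem_stdSimplex hp h1 hG.1 hGp h2 _,
        fun z hz => mirrorUpdate_ne_zero h1 hG.1 hGp h2 _ hz, fun _ x => ?_, fun h' => ?_⟩
      · rw [← fiberSum_fst, fiberSum_mirrorUpdate h1 hG.1 hGp h2]
      · exact absurd h' (Nat.not_odd_iff_even.2 ho.add_one)
    · simp only [upd, if_neg ho]
      refine ⟨mirrorUpdate_mem_stdSimplex hq h1 hG.1 hGq h2 _,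
        fun z hz => mirrorUpdate_ne_zero h1 hG.1 hGq h2 _ hz, fun h' => ?_, fun _ y => ?_⟩
      · exact absurd (Nat.not_odd_iff_even.1 ho).add_one (Nat.not_odd_iff_even.2 h')
      · rw [← fiberSum_snd, fiberSum_mirrorUpdate h1 hG.1 hGq h2]
  have hinv : ∀ k, 1 ≤ k → k ≤ K → F k ∈ stdSimplex ℝ (X × Y) ∧ (∀ z, G z ≠ 0 → F k z ≠ 0) ∧
      (k ≠ 1 → (Even k → ∀ x, ∑ y, F k (x, y) = p x) ∧
        (Odd k → ∀ y, ∑ x, F k (x, y) = q y)) := fun k hk => by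
    induction k, hk using Nat.le_induction with
    | base =>
      intro _
      rw [hF₁]
      refine ⟨⟨fun z => by positivity, ?_⟩, fun z _ => by positivity, fun h => absurd rfl h⟩
      simp only [Finset.sum_const, Finset.card_univ, Fintype.card_prod, nsmul_eq_mul]
      push_cast
      exact mul_one_div_cancel (by positivity)
    | succ k hk ih =>
      intro hkK
      obtain ⟨h1, h2, -⟩ := ih (by omega)
      rw [hupd k hk (by omega)]
      obtain ⟨a1, a2, a3, a4⟩ := hupd_inv k h1 h2
      exact ⟨a1, a2, fun _ => ⟨a3, a4⟩⟩
  -- The uniform start need not satisfy either marginal constraint, so round one only admits the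
  -- coarse bound with its extra `h`.
  have hround : ∀ k, 1 ≤ k → k ≤ K → ∑ z, (roundMatrix p q (F k) z - G z) * g k z ≤
      relEnt G (F k) - relEnt G (upd k) + h ^ 2 / 2 + (if k = 1 then h else 0) := fun k h1 h2 => by
    obtain ⟨a1, a2, a3⟩ := hinv k h1 h2
    have hR := (roundMatrix_mem_couplings hp hq a1.1).1
    split_ifs with hk
    · have : Odd k := hk ▸ odd_one
      simp only [upd, if_pos this]
      exact mirror_round_coarse hp a1 hG.1 hGp a2 hR (hg k h1 h2)
    · rw [add_zero]
      by_cases ho : Odd k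
      · simp only [upd, if_pos ho]
        exact mirror_round hp a1 hG.1 hGp a2 hR
          (le_roundMatrix_of_col hp hq a1.1 ((a3 hk).2 ho)) (hg k h1 h2)
      · simp only [upd, if_neg ho]
        exact mirror_round hq a1 hG.1 hGq a2 hR
          (le_roundMatrix_of_row hp hq a1.1 ((a3 hk).1 (Nat.not_odd_iff_even.1 ho))) (hg k h1 h2)
  have hsum : ∀ n, 1 ≤ n → n ≤ K →
      ∑ k ∈ Finset.Icc 1 n, ∑ z, (roundMatrix p q (F k) z - G z) * g k z ≤
        relEnt G (F 1) - relEnt G (upd n) + n * (h ^ 2 / 2) + h := fun n hn => by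
    induction n, hn using Nat.le_induction with
    | base =>
      intro h1
      simpa using hround 1 le_rfl h1
    | succ n hn ih =>
      intro hnK
      rw [Finset.sum_Icc_succ_top (by omega)]
      have h1 := ih (by omega)
      have h2 := hround (n + 1) (by omega) hnK
      rw [if_neg (by omega), hupd n hn (by omega)] at h2
      rw [hupd n hn (by omega)]
      push_cast
      linarith
  have h1 := hsum K hK le_rfl
  obtain ⟨a1, a2, -⟩ := hinv K hK le_rfl
  obtain ⟨b1, b2, -⟩ := hupd_inv K a1 a2
  have h2 := relEnt_nonneg hG.1 b1 b2
  have h3 := relEnt_const_le hG.1 hn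
  rw [hF₁] at h1
  linarith

end Regret

/-- The step size and the number of rounds turn the regret bound into accuracy `ε`. -/
theorem le_of_regret_bound {C γ ε L η D : ℝ} {K : ℕ} (hγ₁ : γ < 1) (hε : 0 < ε) (hC : 0 < C)
    (hK₁ : 1 ≤ K) (hL : Real.log 2 ≤ L) (hK : 5 * C ^ 2 * L / ((1 - γ) ^ 4 * ε ^ 2) ≤ (K : ℝ))
    (hη : η = (1 - γ) / (3 * C) * Real.sqrt (8 * L / K)) (hεC : ε * (1 - γ) < C) (hγ₀ : 0 < γ)
    (hB : η * (K * ((1 - γ) * D)) ≤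
      L + K * ((η * (C / (1 - γ))) ^ 2 / 2) + η * (C / (1 - γ))) : D ≤ ε := by
  have hg : 0 < 1 - γ := by linarith
  have hL2 : 0.693 < L := by linarith [Real.log_two_gt_d9]
  have hL0 : 0 < L := by linarith
  have hKpos : (0 : ℝ) < K := by exact_mod_cast hK₁
  rw [div_le_iff₀ (by positivity)] at hK
  have hη0 : 0 < η := by rw [hη]; positivity
  have hη2 : η ^ 2 * (9 * C ^ 2 * K) = (1 - γ) ^ 2 * (8 * L) := by
    rw [hη, mul_pow, Real.sq_sqrt (by positivity)]
    field_simp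
    ring
  set h := η * (C / (1 - γ)) with hh
  have hh0 : 0 < h := by positivity
  have hηh : η * C = h * (1 - γ) := by rw [hh]; field_simp
  -- The step size is exactly the one with `K * h ^ 2 = 8 * L / 9`.
  have hh2 : h ^ 2 * (9 * K) = 8 * L := by
    have : (1 - γ) ^ 2 * (h ^ 2 * (9 * K)) = (1 - γ) ^ 2 * (8 * L) := by
      rw [← hη2]
      have e : η ^ 2 * (9 * C ^ 2 * K) = (η * C) ^ 2 * (9 * K) := by ring
      rw [e, hηh]
      ring
    exact mul_left_cancel₀ (by positivity) this
  -- `ε * (1 - γ) < C` gives `K > 5 * L ≥ 5 * log 2 > 3`, and `K` is an integer.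
  have hK4 : (4 : ℝ) ≤ K := by
    have h1 : 5 * L < K := by
      have h2 : 5 * L * C ^ 2 ≤ K * (ε * (1 - γ)) ^ 2 := by
        have e : (K : ℝ) * ((1 - γ) ^ 4 * ε ^ 2) = K * (ε * (1 - γ)) ^ 2 * (1 - γ) ^ 2 := by ring
        have : (1 - γ) ^ 2 ≤ 1 := pow_le_one₀ hg.le (by linarith)
        nlinarith [show 0 ≤ (K : ℝ) * (ε * (1 - γ)) ^ 2 by positivity]
      have h3 : (ε * (1 - γ)) ^ 2 < C ^ 2 := pow_lt_pow_left₀ hεC (by positivity) (by norm_num)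
      have h4 : (K : ℝ) * (ε * (1 - γ)) ^ 2 < K * C ^ 2 := mul_lt_mul_of_pos_left h3 hKpos
      exact lt_of_mul_lt_mul_right (h2.trans_lt h4) (by positivity)
    have h3 : (3 : ℝ) < K := by linarith
    have h4 : 3 < K := by exact_mod_cast h3
    exact_mod_cast h4
  -- Here `h ^ 2 = 8 * L / (9 * K)` is at most `0.36 * L ^ 2` because `L * K > 4 * 0.693`.
  have hhL : h ≤ 0.6 * L := by
    by_contra! hcon
    have h1 : (0.6 * L) ^ 2 < h ^ 2 := pow_lt_pow_left₀ hcon (by positivity) (by norm_num)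
    have h2 : (0.6 * L) ^ 2 * (9 * K) < 8 * L := by
      rw [← hh2]; exact mul_lt_mul_of_pos_right h1 (by positivity)
    have h3 : 0.693 * 4 < L * K := by nlinarith
    nlinarith
  have hKh : K * (h ^ 2 / 2) = 4 / 9 * L := by linarith
  rw [hKh] at hB
  by_contra! hD
  -- `1 + 4 / 9 + 0.6 < 2.05`, whereas the bound on `K` makes the square of the left side at least
  -- `40 / 9 * L ^ 2`, and `40 / 9 > 2.05 ^ 2`.
  have h1 : η * (K * ((1 - γ) * ε)) < 2.05 * L := by
    have : η * (K * ((1 - γ) * ε)) < η * (K * ((1 - γ) * D)) := by gcongr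
    linarith
  have h2 : (η * (K * ((1 - γ) * ε))) ^ 2 < (2.05 * L) ^ 2 :=
    pow_lt_pow_left₀ h1 (by positivity) (by norm_num)
  have h3 : (η * (K * ((1 - γ) * ε))) ^ 2 * (9 * C ^ 2) =
      8 * L * (K * ((1 - γ) ^ 4 * ε ^ 2)) := by
    calc _ = η ^ 2 * (9 * C ^ 2 * K) * (K * ((1 - γ) ^ 2 * ε ^ 2)) := by ring
      _ = _ := by rw [hη2]; ring
  have h4 : 8 * L * (5 * C ^ 2 * L) ≤ 8 * L * (K * ((1 - γ) ^ 4 * ε ^ 2)) :=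
    mul_le_mul_of_nonneg_left hK (by positivity)
  have h5 := mul_lt_mul_of_pos_right h2 (show 0 < 9 * C ^ 2 by positivity)
  rw [h3] at h5
  nlinarith [show 0 < L ^ 2 * C ^ 2 by positivity]

/-! ### Analysis of Sinkhorn Policy Iteration. -/

section Main

variable {X Y : Type*} [Fintype X] [Fintype Y]

theorem IsValid.stdSimplex {PX : X → X → ℝ} {PY : Y → Y → ℝ} {π : X × Y → X × Y → ℝ}
    (h : IsValid PX PY π) (s : X × Y) : π s ∈ stdSimplex ℝ (X × Y) := (h s).1

theorem updateX_eq_mirrorUpdate [DecidableEq X] (PX : X → X → ℝ) (η : ℝ)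
    (π Q : X × Y → X × Y → ℝ) (s : X × Y) :
    updateX PX η π Q s = mirrorUpdate Prod.fst (PX s.1) (fun z => η * Q s z) (π s) := by
  ext z
  simp only [updateX, mirrorUpdate, fiberSum_fst, neg_mul]

theorem updateY_eq_mirrorUpdate [DecidableEq Y] (PY : Y → Y → ℝ) (η : ℝ)
    (π Q : X × Y → X × Y → ℝ) (s : X × Y) :
    updateY PY η π Q s = mirrorUpdate Prod.snd (PY s.2) (fun z => η * Q s z) (π s) := by
  ext z
  simp only [updateY, mirrorUpdate, fiberSum_snd, neg_mul]

variable {PX : X → X → ℝ} (hPX : ∀ x, PX x ∈ stdSimplex ℝ X)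
  {PY : Y → Y → ℝ} (hPY : ∀ y, PY y ∈ stdSimplex ℝ Y)
  {c : X × Y → ℝ} (hc : ∀ s, 0 ≤ c s) {γ : ℝ} (hγ₀ : 0 < γ) (hγ₁ : γ < 1) {η : ℝ} {K : ℕ}
  {π Q : ℕ → X × Y → X × Y → ℝ}

include hPX hPY

theorem IsSPIRun.nonneg (hrun : IsSPIRun PX PY c γ η K (uniformCoupling X Y) π Q) {k : ℕ}
    (h1 : 1 ≤ k) : k ≤ K → ∀ s z, 0 ≤ π k s z := by
  induction k, h1 using Nat.le_induction with
  | base =>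
    intro _ s z
    rw [hrun.init]
    unfold uniformCoupling
    positivity
  | succ k hk ih =>
    intro hkK s z
    have h := ih (by omega)
    by_cases ho : Odd k
    · rw [hrun.update_odd k hk (by omega) ho]
      exact mul_nonneg (div_nonneg (mul_nonneg (h _ _) (Real.exp_pos _).le)
        (Finset.sum_nonneg fun y _ => mul_nonneg (h _ _) (Real.exp_pos _).le)) ((hPX _).1 _)
    · rw [hrun.update_even k hk (by omega) (Nat.not_odd_iff_even.1 ho)]
      exact mul_nonneg (div_nonneg (mul_nonneg (h _ _) (Real.exp_pos _).le)
        (Finset.sum_nonneg fun y _ => mul_nonneg (h _ _) (Real.exp_pos _).le)) ((hPY _).1 _)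

theorem IsSPIRun.isValid_roundCoupling
    (hrun : IsSPIRun PX PY c γ η K (uniformCoupling X Y) π Q) {k : ℕ} (h1 : 1 ≤ k) (hkK : k ≤ K) :
    IsValid PX PY (roundCoupling PX PY (π k)) := fun s =>
  roundMatrix_mem_couplings (hPX s.1) (hPY s.2) (hrun.nonneg hPX hPY h1 hkK s)

include hγ₀ hγ₁

/-- The value functions of the rounded iterates. -/
theorem IsSPIRun.exists_values (hrun : IsSPIRun PX PY c γ η K (uniformCoupling X Y) π Q) :
    ∃ W : ℕ → X × Y → ℝ, ∀ k, 1 ≤ k → k ≤ K →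
      (∀ s, W k s = c s + γ * ∑ z, roundCoupling PX PY (π k) s z * W k z) ∧
      (k < K → ∀ s z, Q k s z = c s + γ * W k z) := by
  have h : ∀ k, ∃ W : X × Y → ℝ, 1 ≤ k → k ≤ K →
      (∀ s, W s = c s + γ * ∑ z, roundCoupling PX PY (π k) s z * W z) ∧
      (k < K → ∀ s z, Q k s z = c s + γ * W z) := fun k => by
    by_cases hk : 1 ≤ k ∧ k ≤ K
    · have hv := (hrun.isValid_roundCoupling hPX hPY hk.1 hk.2).stdSimplex
      by_cases hkK : k < K
      · have hQ : ∀ s z, Q k s z =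
            c s + γ * ∑ w, roundCoupling PX PY (π k) z w * Q k z w := fun s z =>
          congrFun (congrFun (hrun.evaluate k hk.1 hkK) s) z
        -- By the Bellman equation `Q k s z - c s` depends on `z` alone, and is `γ` times this
        -- function.
        refine ⟨fun z => ∑ w, roundCoupling PX PY (π k) z w * Q k z w, fun _ _ =>
          ⟨fun s => ?_, fun _ => hQ⟩⟩
        have e : ∀ w, roundCoupling PX PY (π k) s w * Q k s w =
            roundCoupling PX PY (π k) s w * c s + γ * (roundCoupling PX PY (π k) s w *
              ∑ v, roundCoupling PX PY (π k) w v * Q k w v) := fun w => by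
          rw [hQ s w]; ring
        refine (Finset.sum_congr rfl fun w _ => e w).trans ?_
        rw [Finset.sum_add_distrib, ← Finset.sum_mul, (hv s).2, one_mul, ← Finset.mul_sum]
      -- A run does not constrain `Q K`, so the last value function is constructed separately.
      · obtain ⟨W, hW⟩ := exists_bellman hγ₀ hγ₁ hv c
        exact ⟨W, fun _ _ => ⟨hW, fun h => absurd h hkK⟩⟩
    · exact ⟨0, fun h1 h2 => absurd ⟨h1, h2⟩ hk⟩
  choose W hW using h
  exact ⟨W, hW⟩

variable [MeasurableSpace X] [MeasurableSpace Y] [DiscreteMeasurableSpace X]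
  [DiscreteMeasurableSpace Y]

/-- The output is valid, and its value is the average of the values of the rounded iterates. -/
theorem IsSPIRun.isValid_spiOutput (hrun : IsSPIRun PX PY c γ η K (uniformCoupling X Y) π Q)
    (hK : 1 ≤ K) (s₀ : X × Y) {W : ℕ → X × Y → ℝ} (hW : ∀ k, 1 ≤ k → k ≤ K →
      ∀ s, W k s = c s + γ * ∑ z, roundCoupling PX PY (π k) s z * W k z) :
    IsValid PX PY (spiOutput PX PY γ K s₀ π) ∧
    K * value γ c (spiOutput PX PY γ K s₀ π) s₀ = ∑ k ∈ Finset.Icc 1 K, W k s₀ := by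
  let N : ℕ → Measure (ℕ → X × Y) := fun k => chainLaw (roundCoupling PX PY (π k)) s₀
  have hv : ∀ k ∈ Finset.Icc 1 K, IsValid PX PY (roundCoupling PX PY (π k)) := fun k hk =>
    hrun.isValid_roundCoupling hPX hPY (Finset.mem_Icc.1 hk).1 (Finset.mem_Icc.1 hk).2
  let μ : X × Y → X × Y → ℝ := fun s z =>
    (1 / (K : ℝ)) * ∑ k ∈ Finset.Icc 1 K, pairOcc γ (N k) s z
  have hout : spiOutput PX PY γ K s₀ π = extract PX PY μ := by
    simp only [spiOutput, occupancy_eq_pairOcc hγ₀ hγ₁, μ, N]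
  have hKpos : (0 : ℝ) < K := by exact_mod_cast hK
  have hpair : ∀ k ∈ Finset.Icc 1 K, ∀ s z, pairOcc γ (N k) s z =
      stateOcc γ (N k) s * roundCoupling PX PY (π k) s z := fun k hk s z =>
    pairOcc_chainLaw hγ₀ hγ₁ (hv k hk).stdSimplex s₀ s z
  have hsum : ∀ s, ∑ w, μ s w = (1 / (K : ℝ)) * ∑ k ∈ Finset.Icc 1 K, stateOcc γ (N k) s :=
    fun s => by
      simp only [μ]
      rw [← Finset.mul_sum, Finset.sum_comm]
      simp_rw [sum_pairOcc hγ₀ hγ₁]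
  obtain ⟨h1, h2⟩ := isValid_extract hPX hPY (μ := μ)
    (fun s z => mul_nonneg (by positivity) (Finset.sum_nonneg fun k _ =>
      pairOcc_nonneg hγ₀ hγ₁ (N k) s z))
    (fun s x' => by
      rw [hsum, mul_assoc, Finset.sum_mul]
      simp only [μ]
      rw [← Finset.mul_sum, Finset.sum_comm]
      congr 1
      refine Finset.sum_congr rfl fun k hk => ?_
      simp_rw [hpair k hk]
      rw [← Finset.mul_sum, (hv k hk s).2.1])
    (fun s y' => by
      rw [hsum, mul_assoc, Finset.sum_mul]
      simp only [μ]
      rw [← Finset.mul_sum, Finset.sum_comm]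
      congr 1
      refine Finset.sum_congr rfl fun k hk => ?_
      simp_rw [hpair k hk]
      rw [← Finset.mul_sum, (hv k hk s).2.2])
  rw [hout]
  refine ⟨h1, ?_⟩
  obtain ⟨V, hV⟩ := exists_bellman hγ₀ hγ₁ h1.stdSimplex c
  have e1 : (1 - γ) * V s₀ = (1 - γ) * value γ c (extract PX PY μ) s₀ := by
    rw [value, integral_discountedCost hγ₀ hγ₁]
    exact dot_of_flow hV (flow_dot hγ₀ hγ₁ _ (chainLaw_zero _ _) V)
      (pairOcc_chainLaw hγ₀ hγ₁ h1.stdSimplex s₀)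
  -- The averaged weights obey the flow constraints and disintegrate along the output, so they
  -- determine `V s₀` without being identified as the occupancy of the output chain.
  have e2 : (1 - γ) * V s₀ = ∑ s, (∑ w, μ s w) * c s := by
    refine dot_of_flow hV ?_ h2
    have hk : ∀ k ∈ Finset.Icc 1 K, ∑ z, stateOcc γ (N k) z * V z =
        (1 - γ) * V s₀ + γ * ∑ s, ∑ z, pairOcc γ (N k) s z * V z := fun k _ =>
      flow_dot hγ₀ hγ₁ (N k) (chainLaw_zero _ _) V
    have hk' := Finset.sum_congr rfl hk
    rw [Finset.sum_add_distrib, Finset.sum_const, Nat.card_Icc, ← Finset.mul_sum,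
      Finset.sum_comm] at hk'
    have a1 : ∑ z, (∑ w, μ z w) * V z =
        1 / (K : ℝ) * ∑ z, ∑ k ∈ Finset.Icc 1 K, stateOcc γ (N k) z * V z := by
      rw [Finset.mul_sum]
      refine Finset.sum_congr rfl fun z _ => ?_
      rw [hsum, mul_assoc, Finset.sum_mul]
    have a2 : ∑ s, ∑ z, μ s z * V z =
        1 / (K : ℝ) * ∑ k ∈ Finset.Icc 1 K, ∑ s, ∑ z, pairOcc γ (N k) s z * V z := by
      rw [Finset.sum_comm (s := Finset.Icc 1 K), Finset.mul_sum]
      refine Finset.sum_congr rfl fun s _ => ?_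
      rw [Finset.sum_comm (s := Finset.Icc 1 K), Finset.mul_sum]
      refine Finset.sum_congr rfl fun z _ => ?_
      rw [← Finset.sum_mul, ← mul_assoc]
    rw [a1, a2, hk', nsmul_eq_mul, Nat.add_sub_cancel]
    field_simp
  have e3 : ∑ s, (∑ w, μ s w) * c s =
      1 / (K : ℝ) * ∑ k ∈ Finset.Icc 1 K, (1 - γ) * W k s₀ := by
    have hk : ∀ k ∈ Finset.Icc 1 K, (1 - γ) * W k s₀ = ∑ s, stateOcc γ (N k) s * c s :=
      fun k hk => by
        have hk' := Finset.mem_Icc.1 hk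
        exact dot_of_flow (hW k hk'.1 hk'.2) (flow_dot hγ₀ hγ₁ _ (chainLaw_zero _ _) (W k))
          (hpair k hk)
    rw [Finset.sum_congr rfl hk, Finset.sum_comm, Finset.mul_sum]
    refine Finset.sum_congr rfl fun s _ => ?_
    rw [hsum, mul_assoc, Finset.sum_mul]
  have hg : (1 - γ) ≠ 0 := by linarith
  rw [← Finset.mul_sum] at e3
  have e4 : (1 - γ) * (K * value γ c (extract PX PY μ) s₀) =
      (1 - γ) * ∑ k ∈ Finset.Icc 1 K, W k s₀ := by
    calc _ = K * ((1 - γ) * value γ c (extract PX PY μ) s₀) := by ring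
      _ = K * (1 / (K : ℝ) * ((1 - γ) * ∑ k ∈ Finset.Icc 1 K, W k s₀)) := by
          rw [← e1, e2, e3]
      _ = _ := by field_simp
  exact mul_left_cancel₀ hg e4

include hc

/-- The regret of the output of Sinkhorn Policy Iteration against a bicausal coupling. -/
theorem IsSPIRun.value_sub_le (hrun : IsSPIRun PX PY c γ η K (uniformCoupling X Y) π Q)
    (hK : 1 ≤ K) (hη : 0 ≤ η) {x₀ : X} {y₀ : Y} {M : Measure (ℕ → X × Y)}
    (hM : IsBicausalCoupling PX PY x₀ y₀ M) :
    η * (K * ((1 - γ) * (value γ c (spiOutput PX PY γ K (x₀, y₀) π) (x₀, y₀) -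
      ∫ ω, discountedCost γ c ω ∂M))) ≤
    Real.log ((Fintype.card X : ℝ) * Fintype.card Y) + K * ((η * (‖c‖ / (1 - γ))) ^ 2 / 2) +
      η * (‖c‖ / (1 - γ)) := by
  classical
  have := hM.isProbabilityMeasure
  obtain ⟨W, hW⟩ := hrun.exists_values hPX hPY hγ₀ hγ₁
  obtain ⟨-, hval⟩ := hrun.isValid_spiOutput hPX hPY hγ₀ hγ₁ hK (x₀, y₀)
    fun k h1 h2 => (hW k h1 h2).1
  obtain ⟨G, hG, hMG⟩ := hM.exists_isValid hPX hPY hγ₀ hγ₁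
  set B := Real.log ((Fintype.card X : ℝ) * Fintype.card Y) +
    K * ((η * (‖c‖ / (1 - γ))) ^ 2 / 2) + η * (‖c‖ / (1 - γ)) with hB
  have hg : 0 < 1 - γ := by linarith
  have hreg : ∀ s, ∑ k ∈ Finset.Icc 1 K, ∑ z,
      (roundCoupling PX PY (π k) s z - G s z) * (η * (c s + γ * W k z)) ≤ B := fun s => by
    refine sinkhorn_regret (hPX s.1) (hPY s.2) (hG s) K hK (fun k => π k s)
      (fun k z => η * (c s + γ * W k z)) (fun k h1 h2 z => ?_) ?_ (fun k h1 h2 ho => ?_)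
      (fun k h1 h2 he => ?_)
    · obtain ⟨b1, b2⟩ := bellman_bounds hγ₀ hγ₁
        (hrun.isValid_roundCoupling hPX hPY h1 h2).stdSimplex hc (hW k h1 h2).1 z
      refine ⟨mul_nonneg hη (add_nonneg (hc s) (mul_nonneg hγ₀.le b1)),
        mul_le_mul_of_nonneg_left ?_ hη⟩
      have h3 := (le_abs_self _).trans (norm_le_pi_norm c s)
      have h4 := mul_le_mul_of_nonneg_left b2 hγ₀.le
      have h5 : ‖c‖ + γ * (‖c‖ / (1 - γ)) = ‖c‖ / (1 - γ) := by field_simp; ring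
      linarith
    · rw [hrun.init]; rfl
    · rw [hrun.update_odd k h1 h2 ho, updateX_eq_mirrorUpdate]
      simp_rw [(hW k h1 h2.le).2 h2]
    · rw [hrun.update_even k h1 h2 he, updateY_eq_mirrorUpdate]
      simp_rw [(hW k h1 h2.le).2 h2]
  have hpd : ∀ k ∈ Finset.Icc 1 K,
      (1 - γ) * W k (x₀, y₀) - (1 - γ) * ∫ ω, discountedCost γ c ω ∂M =
        ∑ s, stateOcc γ M s *
          ∑ z, (roundCoupling PX PY (π k) s z - G s z) * (c s + γ * W k z) := fun k hk => by
    have hk' := Finset.mem_Icc.1 hk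
    rw [integral_discountedCost hγ₀ hγ₁]
    exact performance_difference hγ₀ hγ₁
      (hrun.isValid_roundCoupling hPX hPY hk'.1 hk'.2).stdSimplex (hW k hk'.1 hk'.2).1 M
      (hM.apply_zero hPX hPY) G hG.stdSimplex hMG
  have hpd' := Finset.sum_congr rfl hpd
  rw [Finset.sum_sub_distrib, ← Finset.mul_sum, ← hval, Finset.sum_const, Nat.card_Icc,
    Nat.add_sub_cancel, nsmul_eq_mul, Finset.sum_comm] at hpd'
  calc _ = η * ((1 - γ) * (K * value γ c (spiOutput PX PY γ K (x₀, y₀) π) (x₀, y₀)) -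
        K * ((1 - γ) * ∫ ω, discountedCost γ c ω ∂M)) := by ring
    _ = ∑ s, stateOcc γ M s * ∑ k ∈ Finset.Icc 1 K, ∑ z,
          (roundCoupling PX PY (π k) s z - G s z) * (η * (c s + γ * W k z)) := by
        rw [hpd', Finset.mul_sum]
        refine Finset.sum_congr rfl fun s _ => ?_
        rw [← Finset.mul_sum, mul_left_comm, Finset.mul_sum]
        congr 1
        refine Finset.sum_congr rfl fun k _ => ?_
        rw [Finset.mul_sum]
        refine Finset.sum_congr rfl fun z _ => ?_
        ring
    _ ≤ ∑ s, stateOcc γ M s * B := Finset.sum_le_sum fun s _ =>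
        mul_le_mul_of_nonneg_left (hreg s) (stateOcc_nonneg hγ₀ hγ₁ M s)
    _ = B := by rw [← Finset.sum_mul, sum_stateOcc hγ₀ hγ₁, one_mul]

omit hPX hPY

theorem integral_discountedCost_nonneg (M : Measure (ℕ → X × Y)) :
    0 ≤ ∫ ω, discountedCost γ c ω ∂M :=
  integral_nonneg fun ω => tsum_nonneg fun t => mul_nonneg (pow_pos hγ₀ t).le (hc (ω t))

theorem integral_discountedCost_le (M : Measure (ℕ → X × Y)) [IsProbabilityMeasure M] :
    ∫ ω, discountedCost γ c ω ∂M ≤ ‖c‖ / (1 - γ) := by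
  rw [le_div_iff₀' (by linarith), integral_discountedCost hγ₀ hγ₁]
  calc ∑ s, stateOcc γ M s * c s ≤ ∑ s, stateOcc γ M s * ‖c‖ :=
        Finset.sum_le_sum fun s _ => mul_le_mul_of_nonneg_left
          ((le_abs_self _).trans (norm_le_pi_norm c s)) (stateOcc_nonneg hγ₀ hγ₁ M s)
    _ = ‖c‖ := by rw [← Finset.sum_mul, sum_stateOcc hγ₀ hγ₁, one_mul]

end Main

end MarkovOT

end

theorem mainTheorem3 {X Y : Type*} [Fintype X] [Fintype Y]
    [MeasurableSpace X] [MeasurableSpace Y] [DiscreteMeasurableSpace X] [DiscreteMeasurableSpace Y]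
    (PX : X → X → ℝ) (hPX : ∀ x, PX x ∈ stdSimplex ℝ X)
    (PY : Y → Y → ℝ) (hPY : ∀ y, PY y ∈ stdSimplex ℝ Y)
    (c : X × Y → ℝ) (hc : ∀ s, 0 ≤ c s)
    (γ : ℝ) (hγ₀ : 0 < γ) (hγ₁ : γ < 1)
    (ε : ℝ) (hε : 0 < ε)
    (K : ℕ) (hK₁ : 1 ≤ K)
    (hK : 5 * ‖c‖ ^ 2 * Real.log ((Fintype.card X : ℝ) * Fintype.card Y) / ((1 - γ) ^ 4 * ε ^ 2)
      ≤ (K : ℝ))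
    (η : ℝ)
    (hη : η = (1 - γ) / (3 * ‖c‖) *
      Real.sqrt (8 * Real.log ((Fintype.card X : ℝ) * Fintype.card Y) / K))
    (π Q : ℕ → X × Y → X × Y → ℝ)
    (hrun : MarkovOT.IsSPIRun PX PY c γ η K (MarkovOT.uniformCoupling X Y) π Q)
    (x₀ : X) (y₀ : Y) :
    MarkovOT.IsValid PX PY (MarkovOT.spiOutput PX PY γ K (x₀, y₀) π) ∧
    MarkovOT.value γ c (MarkovOT.spiOutput PX PY γ K (x₀, y₀) π) (x₀, y₀)
      ≤ MarkovOT.otDist γ PX PY c x₀ y₀ + ε := by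
  open MarkovOT in
  obtain ⟨W, hW⟩ := hrun.exists_values hPX hPY hγ₀ hγ₁
  refine ⟨(hrun.isValid_spiOutput hPX hPY hγ₀ hγ₁ hK₁ (x₀, y₀)
    fun k h1 h2 => (hW k h1 h2).1).1, ?_⟩
  have hg : 0 < 1 - γ := by linarith
  rw [← sub_le_iff_le_add]
  obtain ⟨M₀, hM₀⟩ := exists_isBicausalCoupling hPX hPY x₀ y₀
  refine le_csInf ⟨_, M₀, hM₀, rfl⟩ ?_
  rintro _ ⟨M, hM, rfl⟩
  have := hM.isProbabilityMeasure
  have hM0 := integral_discountedCost_nonneg hc hγ₀ hγ₁ M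
  rw [sub_le_comm]
  -- If `‖c‖ ≤ ε * (1 - γ)`, every discounted cost is at most `ε`. This case absorbs `c = 0`.
  rcases le_or_gt ‖c‖ (ε * (1 - γ)) with hεc | hεc
  · have h1 := integral_discountedCost_le hc hγ₀ hγ₁
      (chainLaw (spiOutput PX PY γ K (x₀, y₀) π) (x₀, y₀))
    have h2 : ‖c‖ / (1 - γ) ≤ ε := (div_le_iff₀ hg).2 hεc
    unfold value
    linarith
  have hC : 0 < ‖c‖ := (mul_pos hε hg).trans hεc
  have hcX : 0 < Fintype.card X := Fintype.card_pos_iff.2 ⟨x₀⟩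
  have hcY : 0 < Fintype.card Y := Fintype.card_pos_iff.2 ⟨y₀⟩
  -- With one joint state there is only one path; otherwise the logarithm is at least `log 2`, as
  -- the constants require.
  rcases Nat.lt_or_ge (Fintype.card X * Fintype.card Y) 2 with hcard | hcard
  · have hsub : Subsingleton (X × Y) := by
      rw [← Fintype.card_le_one_iff_subsingleton, Fintype.card_prod]
      omega
    have hconst : discountedCost γ c = fun _ => discountedCost γ c fun _ => (x₀, y₀) := by
      ext ω
      rw [Subsingleton.elim ω fun _ => (x₀, y₀)]
    rw [value, hconst, integral_const, integral_const, probReal_univ, probReal_univ, sub_self]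
    exact hε.le
  · have hL : Real.log 2 ≤ Real.log ((Fintype.card X : ℝ) * Fintype.card Y) :=
      Real.log_le_log (by norm_num) (by exact_mod_cast hcard)
    refine le_of_regret_bound hγ₁ hε hC hK₁ hL hK hη hεc hγ₀ ?_
    exact hrun.value_sub_le hPX hPY hc hγ₀ hγ₁ hK₁ (by rw [hη]; positivity) hM
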